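/- Let $n\ge 1$. Let $V=\mathbb C^{n+1}$ with standard basis $f_1,\dots,f_{n+1}$, let $W=\mathbb C^{2n}$ with standard basis $e_1,\dots,e_{2n}$, and let $\mathrm{pr}_k:V\to V$ be the projection along $f_k$ ($f_k\mapsto 0$, $f_j\mapsto f_j$ for $j\ne k$). The complete degenerate flag variety is $$\mathcal{F}l^a_{n+1}=\Big\{(V_1,\dots,V_n)\in\prod_{i=1}^n \mathrm{Gr}_i(V)\ \Big|\ \mathrm{pr}_i(V_i)\subseteq V_{i+1}\ \text{ for } 1\le i\le n-1\Big\}.$$ Let $T\subset B\subset SL_{2n}(\mathbb C)$ be the subgroups of diagonal and of upper triangular matrices, and let $P=P_{\omega_1+\omega_3+\dots+\omega_{2n-1}}$ be the parabolic subgroup stabilizing the flag $\langle e_1\rangle\subset\langle e_1,e_2,e_3\rangle\subset\dots\subset\langle e_1,\dots,e_{2n-1}\rangle$. By acting on this flag, $SL_{2n}/P$ is identified with the set of partial flags $W_1\subset\dots\subset W_n$ in $W$ with $\dim W_i=2i-1$. Let $\sigma\in\mathrm{Sym}_{2n}$ be given by $\sigma(2k)=k$ for $1\le k\le n$ and $\sigma(2k+1)=n+1+k$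 for $0\le k\le n-1$, and let $X_\sigma=\overline{B\sigma P/P}\subset SL_{2n}/P$ be the corresponding Schubert variety (Zariski closure). The torus $T$ acts on $SL_{2n}/P$ by left multiplication. It acts on $\mathcal{F}l^a_{n+1}$ as follows: $t=\mathrm{diag}(\lambda_1,\dots,\lambda_{2n})$ sends $(V_1,\dots,V_n)$ to $(t^{(1)}V_1,\dots,t^{(n)}V_n)$, where $t^{(i)}f_k=\lambda_kf_k$ for $i\le k\le n+1$ and $t^{(i)}f_k=\lambda_{n+1+k}f_k$ for $1\le k\le i-1$. For $1\le i\le n$ let $\pi_i:\langle e_1,\dots,e_{n+i}\rangle\to V$ be the linear surjection with $\pi_i(e_k)=0$ for $1\le k\le i-1$, $\pi_i(e_k)=f_k$ for $i\le k\le n+1$, and $\pi_i(e_k)=f_{k-n-1}$ for $n+2\le k\le n+i$. Theorem. The map $(V_1,\dots,V_n)\mapsto(\pi_1^{-1}(V_1),\dots,\pi_n^{-1}(V_n))$ defines a $T$-equivariant isomorphism of projective varieties $$\zeta:\mathcal{F}l^a_{n+1}\xrightarrow{\ \simeq\ }X_\sigma\subset SL_{2n}/P ,$$ and its image $X_\sigma$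 is the set of partial flags $W_1\subset\dots\subset W_n$ with $\dim W_i=2i-1$ and $\langle e_1,\dots,e_{i-1}\rangle\subseteq W_i\subseteq\langle e_1,\dots,e_{n+i}\rangle$ for all $1\le i\le n$. -/

import Mathlib

open scoped Topology

namespace DegFlagSchubert

noncomputable section

/-! ### Products of Grassmannians as multiprojective varieties -/

/-- The Grassmannian `Gr_d(ℂ^N)` of `d`-dimensional subspaces of `ℂ^N`. -/
abbrev Grass (d N : ℕ) : Type :=
  {U : Submodule ℂ (Fin N → ℂ) // Module.finrank ℂ U = d}

/-- Homogeneous Plücker coordinates of a point of `Gr_d(ℂ^N)`: the maximal minors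
(indexed by the increasing sequences of `d` row indices) of the `N × d` matrix whose columns form a
basis of the subspace. Another basis rescales all of them by one common nonzero factor. -/
def pluckerCoord {d N : ℕ} (U : Grass d N) (S : Fin d ↪o Fin N) : ℂ :=
  Matrix.det (Matrix.of fun a b : Fin d =>
    ((Module.finBasisOfFinrankEq ℂ U.1 U.2 b : U.1) : Fin N → ℂ) (S a))

section Multiprojective

variable {ι : Type} {κ : ι → Type} {ι' : Type} {κ' : ι' → Type} {X Y : Type}

/-- A polynomial in the variables `x_{i,k}` is multihomogeneous of multidegree `m` if it is
homogeneous of degree `m i` in the `i`-th group of variables, for every `i`. -/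
def IsMultihomogeneous (p : MvPolynomial (Σ i, κ i) ℂ) (m : ι →₀ ℕ) : Prop :=
  MvPolynomial.IsWeightedHomogeneous (fun s : Σ i, κ i => Finsupp.single s.1 1) p m

/-- The Zariski topology on a set `X` whose points are given by homogeneous coordinates `c x i`
in a product of projective spaces indexed by `i : ι` (the topology induced from that product):
a basis of open sets is given by the non-vanishing loci of multihomogeneous polynomials. -/
@[reducible] def zariski (c : X → (i : ι) → κ i → ℂ) : TopologicalSpace X :=
  TopologicalSpace.generateFrom
    {D : Set X | ∃ (p : MvPolynomial (Σ i, κ i) ℂ) (m : ι →₀ ℕ), IsMultihomogeneous p m ∧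
      D = {x | MvPolynomial.eval (fun s => c x s.1 s.2) p ≠ 0}}

/-- `h` is a regular function on `U`: locally on `U` it is a quotient of two multihomogeneous
polynomials of the same multidegree in the homogeneous coordinates. -/
def IsRegularOn (c : X → (i : ι) → κ i → ℂ) (U : Set X) (h : X → ℂ) : Prop :=
  ∀ x ∈ U, ∃ (p q : MvPolynomial (Σ i, κ i) ℂ) (m : ι →₀ ℕ) (D : Set X),
    IsMultihomogeneous p m ∧ IsMultihomogeneous q m ∧ IsOpen[zariski c] D ∧ x ∈ D ∧
    ∀ y ∈ D ∩ U, MvPolynomial.eval (fun s => c y s.1 s.2) q ≠ 0 ∧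
      h y = MvPolynomial.eval (fun s => c y s.1 s.2) p /
        MvPolynomial.eval (fun s => c y s.1 s.2) q

/-- Morphisms of varieties: Zariski continuous maps that pull back regular functions on open sets
to regular functions. -/
def IsMorphism (c : X → (i : ι) → κ i → ℂ) (c' : Y → (i : ι') → κ' i → ℂ) (f : X → Y) : Prop :=
  Continuous[zariski c, zariski c'] f ∧
  ∀ (U : Set Y) (h : Y → ℂ), IsOpen[zariski c'] U → IsRegularOn c' U h →
    IsRegularOn c (f ⁻¹' U) (h ∘ f)

/-- Isomorphisms of varieties: bijections that are morphisms in both directions. -/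
def IsVarietyIso (c : X → (i : ι) → κ i → ℂ) (c' : Y → (i : ι') → κ' i → ℂ) (f : X ≃ Y) : Prop :=
  IsMorphism c c' f ∧ IsMorphism c' c f.symm

end Multiprojective

/-! ### The group `SL_{2n}`, its Borel subgroup and its maximal torus -/

/-- `SL_{2n}(ℂ)`. -/
abbrev SLG (n : ℕ) : Type := Matrix.SpecialLinearGroup (Fin (2 * n)) ℂ

/-- The subgroup `B` of upper triangular matrices. -/
def borel (n : ℕ) : Subgroup (SLG n) where
  carrier := {g | ∀ i j, j < i → (g : Matrix (Fin (2 * n)) (Fin (2 * n)) ℂ) i j = 0}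
  one_mem' := by
    intro i j h
    simp [h.ne']
  mul_mem' := by
    intro a b ha hb
    have ha' : (a : Matrix (Fin (2 * n)) (Fin (2 * n)) ℂ).BlockTriangular id :=
      fun i j h => ha i j h
    have hb' : (b : Matrix (Fin (2 * n)) (Fin (2 * n)) ℂ).BlockTriangular id :=
      fun i j h => hb i j h
    intro i j h
    rw [Matrix.SpecialLinearGroup.coe_mul]
    exact ha'.mul hb' h
  inv_mem' := by
    intro a ha
    have ha' : (a : Matrix (Fin (2 * n)) (Fin (2 * n)) ℂ).BlockTriangular id :=
      fun i j h => ha i j h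
    have e : ((a⁻¹ : SLG n) : Matrix (Fin (2 * n)) (Fin (2 * n)) ℂ)
        = (a : Matrix (Fin (2 * n)) (Fin (2 * n)) ℂ)⁻¹ := by
      rw [Matrix.SpecialLinearGroup.coe_inv, Matrix.inv_def]
      simp
    have : Invertible (a : Matrix (Fin (2 * n)) (Fin (2 * n)) ℂ) :=
      Matrix.invertibleOfIsUnitDet _ (by simp)
    intro i j h
    rw [e]
    exact Matrix.blockTriangular_inv_of_blockTriangular ha' h

/-- The maximal torus `T` of diagonal matrices. -/
def torus (n : ℕ) : Subgroup (SLG n) where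
  carrier := {g | ∀ i j, i ≠ j → (g : Matrix (Fin (2 * n)) (Fin (2 * n)) ℂ) i j = 0}
  one_mem' := by
    intro i j h
    simp [h]
  mul_mem' := by
    intro a b ha hb i j h
    rw [Matrix.SpecialLinearGroup.coe_mul, Matrix.mul_apply]
    refine Finset.sum_eq_zero fun k _ => ?_
    by_cases hk : i = k
    · subst hk
      rw [hb i j h, mul_zero]
    · rw [ha i k hk, zero_mul]
  inv_mem' := by
    intro a ha
    have h1 := (borel n).inv_mem (x := a) (fun i j h => ha i j h.ne')
    have h2 := (borel n).inv_mem (x := a.transpose)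
      (fun i j h => by
        rw [Matrix.SpecialLinearGroup.coe_transpose, Matrix.transpose_apply]
        exact ha j i h.ne)
    intro i j h
    rcases lt_or_gt_of_ne h with h' | h'
    · have := h2 j i h'
      rw [Matrix.SpecialLinearGroup.coe_inv, Matrix.SpecialLinearGroup.coe_transpose,
        ← Matrix.adjugate_transpose, Matrix.transpose_apply] at this
      rw [Matrix.SpecialLinearGroup.coe_inv]
      exact this
    · exact h1 i j h'

/-! ### Partial flags and `SL_{2n}/P` -/

/-- Partial flags `W_1 ⊆ W_2 ⊆ ⋯ ⊆ W_n` in `ℂ^{2n}` with `dim W_i = 2i - 1`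
(indices are shifted by one: `i : Fin n` stands for `i + 1`). -/
abbrev PartialFlag (n : ℕ) : Type :=
  {W : (i : Fin n) → Grass (2 * (i : ℕ) + 1) (2 * n) // ∀ i j, i ≤ j → (W i).1 ≤ (W j).1}

/-- The action of a matrix on `ℂ^{2n}`, as a linear automorphism. -/
def slEquiv {n : ℕ} (g : SLG n) : (Fin (2 * n) → ℂ) ≃ₗ[ℂ] (Fin (2 * n) → ℂ) :=
  Matrix.SpecialLinearGroup.toLin' g

/-- `SL_{2n}` acts on partial flags by `(g • W)_i = g W_i`. -/
instance (n : ℕ) : MulAction (SLG n) (PartialFlag n) where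
  smul g W := ⟨fun i => ⟨(W.1 i).1.map (slEquiv g : (Fin (2 * n) → ℂ) →ₗ[ℂ] (Fin (2 * n) → ℂ)),
      (LinearEquiv.finrank_map_eq (slEquiv g) _).trans (W.1 i).2⟩,
    fun i j h => Submodule.map_mono (W.2 i j h)⟩
  one_smul W := by
    apply Subtype.ext
    funext i
    apply Subtype.ext
    change (W.1 i).1.map (slEquiv (1 : SLG n) : (Fin (2 * n) → ℂ) →ₗ[ℂ] _) = (W.1 i).1
    have : (slEquiv (1 : SLG n) : (Fin (2 * n) → ℂ) →ₗ[ℂ] (Fin (2 * n) → ℂ)) = LinearMap.id := by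
      simp [slEquiv]
    rw [this, Submodule.map_id]
  mul_smul g h W := by
    apply Subtype.ext
    funext i
    apply Subtype.ext
    change (W.1 i).1.map (slEquiv (g * h) : (Fin (2 * n) → ℂ) →ₗ[ℂ] (Fin (2 * n) → ℂ)) =
      ((W.1 i).1.map (slEquiv h : (Fin (2 * n) → ℂ) →ₗ[ℂ] (Fin (2 * n) → ℂ))).map
        (slEquiv g : (Fin (2 * n) → ℂ) →ₗ[ℂ] (Fin (2 * n) → ℂ))
    rw [← Submodule.map_comp]
    congr 1
    simp only [slEquiv, map_mul]
    rfl

/-- The coordinate subspace `⟨e_1, …, e_m⟩` of `ℂ^{2n}` (`m ≤ 2n`). -/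
def coordSpan (n m : ℕ) : Submodule ℂ (Fin (2 * n) → ℂ) :=
  Submodule.span ℂ {v | ∃ k : Fin (2 * n), (k : ℕ) < m ∧ v = Pi.single k 1}

theorem finrank_coordSpan (n m : ℕ) (h : m ≤ 2 * n) :
    Module.finrank ℂ (coordSpan n m) = m := by
  have hs : {v : Fin (2 * n) → ℂ | ∃ k : Fin (2 * n), (k : ℕ) < m ∧ v = Pi.single k 1} =
      Set.range (fun a : Fin m => (Pi.single (Fin.castLE h a) 1 : Fin (2 * n) → ℂ)) := by
    ext v
    constructor
    · rintro ⟨k, hk, rfl⟩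
      exact ⟨⟨k, hk⟩, rfl⟩
    · rintro ⟨a, rfl⟩
      exact ⟨Fin.castLE h a, a.2, rfl⟩
  have hl : LinearIndependent ℂ
      (fun a : Fin m => (Pi.single (Fin.castLE h a) 1 : Fin (2 * n) → ℂ)) := by
    have := (Pi.basisFun ℂ (Fin (2 * n))).linearIndependent.comp (Fin.castLE h)
      (Fin.castLE_injective h)
    convert this using 1
    funext a
    simp
  rw [coordSpan, hs, finrank_span_eq_card hl, Fintype.card_fin]

/-- The standard flag `⟨e_1⟩ ⊆ ⟨e_1, e_2, e_3⟩ ⊆ ⋯ ⊆ ⟨e_1, …, e_{2n-1}⟩`. -/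
def stdFlag (n : ℕ) : PartialFlag n :=
  ⟨fun i => ⟨coordSpan n (2 * (i : ℕ) + 1), finrank_coordSpan n _ (by omega)⟩,
    fun i j h => Submodule.span_mono (by
      rintro v ⟨k, hk, rfl⟩
      have h' : (i : ℕ) ≤ (j : ℕ) := h
      exact ⟨k, by omega, rfl⟩)⟩

/-- The parabolic subgroup `P = P_{ω_1+ω_3+⋯+ω_{2n-1}}`: the stabilizer of the standard flag with
subspaces of dimensions `1, 3, …, 2n-1` (equivalently of the lines spanned by the highest weight
vectors `e_1 ∧ ⋯ ∧ e_{2i-1}` of the fundamental representations of highest weights `ω_{2i-1}`). -/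
def parabolic (n : ℕ) : Subgroup (SLG n) := MulAction.stabilizer (SLG n) (stdFlag n)

/-- `SL_{2n}/P`. -/
abbrev GmodP (n : ℕ) : Type := SLG n ⧸ parabolic n

/-- The natural map from `SL_{2n}/P` to partial flags, `gP ↦ g • stdFlag`. -/
def toFlag (n : ℕ) : GmodP n → PartialFlag n :=
  MulAction.ofQuotientStabilizer (SLG n) (stdFlag n)

/-- The Plücker coordinates of points of `SL_{2n}/P`, embedded through partial flags into
`∏ Gr_{2i-1}(ℂ^{2n})`. -/
def coordGmodP (n : ℕ) (x : GmodP n) (i : Fin n) (S : Fin (2 * (i : ℕ) + 1) ↪o Fin (2 * n)) : ℂ :=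
  pluckerCoord ((toFlag n x).1 i) S

/-! ### Schubert varieties -/

/-- `w ∈ SL_{2n}` represents the permutation `τ`, i.e. `w e_j ∈ ℂ e_{τ(j)}` for all `j`. -/
def Represents {n : ℕ} (w : SLG n) (τ : Equiv.Perm (Fin (2 * n))) : Prop :=
  ∀ i j, i ≠ τ j → (w : Matrix (Fin (2 * n)) (Fin (2 * n)) ℂ) i j = 0

/-- The Schubert cell `BτP/P`. -/
def schubertCell (n : ℕ) (τ : Equiv.Perm (Fin (2 * n))) : Set (GmodP n) :=
  {x | ∃ b ∈ borel n, ∃ w : SLG n, Represents w τ ∧ x = QuotientGroup.mk (b * w)}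

/-- The Schubert variety `X_τ`, the Zariski closure of `BτP/P` in `SL_{2n}/P`. -/
def schubertVariety (n : ℕ) (τ : Equiv.Perm (Fin (2 * n))) : Set (GmodP n) :=
  closure[zariski (coordGmodP n)] (schubertCell n τ)

/-- The Plücker coordinates on `X_τ ⊆ SL_{2n}/P`. -/
def coordSchubert (n : ℕ) (τ : Equiv.Perm (Fin (2 * n))) (x : schubertVariety n τ) (i : Fin n)
    (S : Fin (2 * (i : ℕ) + 1) ↪o Fin (2 * n)) : ℂ :=
  coordGmodP n x.1 i S

/-- The permutation `σ(2k) = k`, `σ(2k+1) = n+1+k` of `{1, …, 2n}`, written on `{0, …, 2n-1}`: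
`2k - 1 ↦ k - 1` and `2k ↦ n + k`. -/
def sigma (n : ℕ) : Equiv.Perm (Fin (2 * n)) where
  toFun r := if (r : ℕ) % 2 = 0 then ⟨n + (r : ℕ) / 2, by omega⟩ else ⟨(r : ℕ) / 2, by omega⟩
  invFun s := if h : (s : ℕ) < n then ⟨2 * (s : ℕ) + 1, by omega⟩
    else ⟨2 * ((s : ℕ) - n), by omega⟩
  left_inv r := by
    apply Fin.ext
    have := r.2
    by_cases h : (r : ℕ) % 2 = 0
    · simp [h]
      omega
    · have h' : (r : ℕ) / 2 < n := by omega
      simp [h, h']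
      omega
  right_inv s := by
    apply Fin.ext
    have := s.2
    by_cases h : (s : ℕ) < n
    · have h' : (2 * (s : ℕ) + 1) % 2 ≠ 0 := by omega
      simp [h]
      omega
    · simp [h]
      omega

/-! ### The degenerate flag variety -/

/-- The projection `pr_k` of `V = ℂ^{n+1}` along the `k`-th basis vector. -/
def pr (n : ℕ) (k : Fin (n + 1)) : (Fin (n + 1) → ℂ) →ₗ[ℂ] (Fin (n + 1) → ℂ) :=
  LinearMap.pi fun j => if j = k then 0 else LinearMap.proj j

/-- The complete degenerate flag variety `Fl^a_{n+1}`: tuples `(V_1, …, V_n) ∈ ∏ Gr_i(V)` with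
`pr_i(V_i) ⊆ V_{i+1}` for `1 ≤ i ≤ n-1` (indices are shifted by one: `i : Fin n` stands for
`i + 1`). -/
abbrev DegFlag (n : ℕ) : Type :=
  {V : (i : Fin n) → Grass ((i : ℕ) + 1) (n + 1) //
    ∀ i j : Fin n, (j : ℕ) = (i : ℕ) + 1 → (V i).1.map (pr n i.castSucc) ≤ (V j).1}

/-- The Plücker coordinates on `Fl^a_{n+1} ⊆ ∏ Gr_i(V)`. -/
def coordDegFlag (n : ℕ) (V : DegFlag n) (i : Fin n)
    (S : Fin ((i : ℕ) + 1) ↪o Fin (n + 1)) : ℂ :=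
  pluckerCoord (V.1 i) S

/-- The index of the diagonal entry of `T` by which `T` rescales the basis vector `f_k` of the
`i`-th copy of `V`: `k` if `k ≥ i`, and `n+1+k` if `k < i`. -/
def torusIndex {n : ℕ} (i : Fin n) (k : Fin (n + 1)) : Fin (2 * n) :=
  if h : (k : ℕ) < (i : ℕ) then ⟨n + 1 + (k : ℕ), by omega⟩ else ⟨(k : ℕ), by omega⟩

theorem torus_entry_ne_zero {n : ℕ} (t : torus n) (k : Fin (2 * n)) :
    (t.1 : Matrix (Fin (2 * n)) (Fin (2 * n)) ℂ) k k ≠ 0 := by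
  intro h
  have hd : (t.1 : Matrix (Fin (2 * n)) (Fin (2 * n)) ℂ).det = 0 := by
    apply Matrix.det_eq_zero_of_row_eq_zero k
    intro j
    by_cases hj : k = j
    · rw [← hj, h]
    · exact t.2 k j hj
  rw [t.1.2] at hd
  exact one_ne_zero hd

/-- The action of `t = diag(λ_1, …, λ_{2n}) ∈ T` on the `i`-th copy of `V`:
`f_k ↦ λ_k f_k` if `k ≥ i`, and `f_k ↦ λ_{n+1+k} f_k` if `k < i`. -/
def torusEquiv {n : ℕ} (i : Fin n) (t : torus n) :
    (Fin (n + 1) → ℂ) ≃ₗ[ℂ] (Fin (n + 1) → ℂ) :=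
  LinearEquiv.piCongrRight fun k =>
    LinearEquiv.smulOfNeZero ℂ ℂ
      ((t.1 : Matrix (Fin (2 * n)) (Fin (2 * n)) ℂ) (torusIndex i k) (torusIndex i k))
      (torus_entry_ne_zero t _)

theorem torusEquiv_apply {n : ℕ} (i : Fin n) (t : torus n) (v : Fin (n + 1) → ℂ)
    (k : Fin (n + 1)) :
    torusEquiv i t v k =
      (t.1 : Matrix (Fin (2 * n)) (Fin (2 * n)) ℂ) (torusIndex i k) (torusIndex i k) * v k :=
  rfl

theorem pr_torusEquiv {n : ℕ} (i j : Fin n) (h : (j : ℕ) = (i : ℕ) + 1) (t : torus n)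
    (v : Fin (n + 1) → ℂ) :
    pr n i.castSucc (torusEquiv i t v) = torusEquiv j t (pr n i.castSucc v) := by
  funext k
  rw [torusEquiv_apply]
  by_cases hk : k = i.castSucc
  · simp [pr, hk]
  · have hk' : (k : ℕ) ≠ (i : ℕ) := fun e => hk (Fin.ext e)
    have hidx : torusIndex i k = torusIndex j k := by
      unfold torusIndex
      by_cases h1 : (k : ℕ) < (i : ℕ)
      · rw [dif_pos h1, dif_pos (by omega)]
      · rw [dif_neg h1, dif_neg (by omega)]
    simp [pr, hk, torusEquiv_apply, hidx]

/-- `T` acts on `Fl^a_{n+1}` by `(t • V)_i = t^{(i)} V_i`, where `t^{(i)}` is the action of `t` on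
the `i`-th copy of `V`. -/
instance (n : ℕ) : MulAction (torus n) (DegFlag n) where
  smul t V :=
    ⟨fun i => ⟨(V.1 i).1.map (torusEquiv i t : (Fin (n + 1) → ℂ) →ₗ[ℂ] (Fin (n + 1) → ℂ)),
      (LinearEquiv.finrank_map_eq (torusEquiv i t) _).trans (V.1 i).2⟩, by
    rintro i j h _ ⟨_, ⟨v, hv, rfl⟩, rfl⟩
    exact ⟨pr n i.castSucc v, V.2 i j h ⟨v, hv, rfl⟩, (pr_torusEquiv i j h t v).symm⟩⟩
  one_smul V := by
    apply Subtype.ext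
    funext i
    apply Subtype.ext
    change (V.1 i).1.map (torusEquiv i (1 : torus n) : (Fin (n + 1) → ℂ) →ₗ[ℂ] _) = (V.1 i).1
    have : (torusEquiv i (1 : torus n) : (Fin (n + 1) → ℂ) →ₗ[ℂ] (Fin (n + 1) → ℂ))
        = LinearMap.id := by
      refine LinearMap.ext fun v => funext fun k => ?_
      change torusEquiv i (1 : torus n) v k = v k
      rw [torusEquiv_apply]
      simp
    rw [this, Submodule.map_id]
  mul_smul s t V := by
    apply Subtype.ext
    funext i
    apply Subtype.ext
    change (V.1 i).1.map (torusEquiv i (s * t) : (Fin (n + 1) → ℂ) →ₗ[ℂ] (Fin (n + 1) → ℂ)) =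
      ((V.1 i).1.map (torusEquiv i t : (Fin (n + 1) → ℂ) →ₗ[ℂ] (Fin (n + 1) → ℂ))).map
        (torusEquiv i s : (Fin (n + 1) → ℂ) →ₗ[ℂ] (Fin (n + 1) → ℂ))
    rw [← Submodule.map_comp]
    congr 1
    refine LinearMap.ext fun v => funext fun k => ?_
    change torusEquiv i (s * t) v k = torusEquiv i s (torusEquiv i t v) k
    rw [torusEquiv_apply, torusEquiv_apply, torusEquiv_apply]
    have : ((s * t : torus n).1 : Matrix (Fin (2 * n)) (Fin (2 * n)) ℂ)
        (torusIndex i k) (torusIndex i k) =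
        (s.1 : Matrix (Fin (2 * n)) (Fin (2 * n)) ℂ) (torusIndex i k) (torusIndex i k) *
        (t.1 : Matrix (Fin (2 * n)) (Fin (2 * n)) ℂ) (torusIndex i k) (torusIndex i k) := by
      rw [Subgroup.coe_mul, Matrix.SpecialLinearGroup.coe_mul, Matrix.mul_apply]
      refine Finset.sum_eq_single _ (fun l _ hl => ?_) (fun h => absurd (Finset.mem_univ _) h)
      rw [s.2 _ _ hl.symm, zero_mul]
    rw [this, mul_assoc]

/-! ### The maps `π_i` and the subspaces `π_i⁻¹(V_i)` -/

/-- The surjection `π_i : U_{n+i} = ⟨e_1, …, e_{n+i}⟩ → V`, given by `e_k ↦ 0` for `k ≤ i-1`,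
`e_k ↦ f_k` for `i ≤ k ≤ n+1` and `e_k ↦ f_{k-n-1}` for `n+2 ≤ k ≤ n+i`
(all indices are shifted by one). -/
def piMap {n : ℕ} (i : Fin n) : coordSpan n (n + (i : ℕ) + 1) →ₗ[ℂ] (Fin (n + 1) → ℂ) :=
  ((Pi.basisFun ℂ (Fin (2 * n))).constr ℂ (fun k =>
    if (k : ℕ) < (i : ℕ) then (0 : Fin (n + 1) → ℂ)
    else if h : (k : ℕ) ≤ n then Pi.single (⟨k, by omega⟩ : Fin (n + 1)) 1
    else Pi.single (⟨(k : ℕ) - n - 1, by omega⟩ : Fin (n + 1)) 1)).domRestrict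
      (coordSpan n (n + (i : ℕ) + 1))

/-- The subspace `π_i⁻¹(U)` of `⟨e_1, …, e_{n+i}⟩ ⊆ ℂ^{2n}`. -/
def piPreimage {n : ℕ} (i : Fin n) (U : Submodule ℂ (Fin (n + 1) → ℂ)) :
    Submodule ℂ (Fin (2 * n) → ℂ) :=
  (U.comap (piMap i)).map (coordSpan n (n + (i : ℕ) + 1)).subtype

/-- The set of partial flags with `⟨e_1, …, e_{i-1}⟩ ⊆ W_i ⊆ ⟨e_1, …, e_{n+i}⟩` for all `i`. -/
def Y (n : ℕ) : Set (PartialFlag n) :=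
  {W | ∀ i : Fin n, coordSpan n (i : ℕ) ≤ (W.1 i).1 ∧ (W.1 i).1 ≤ coordSpan n (n + (i : ℕ) + 1)}

end

end DegFlagSchubert

namespace DegFlagSchubert

noncomputable section

/-! ### Maps between multiprojective varieties given by linear forms in the coordinates -/

section Multiprojective

variable {ι : Type} {κ κ' : ι → Type} {X Y : Type}

/-! Write Y for the set of flags described by the two bounds on each `W_i`. Such a `W_i` is the same
thing as a subspace of `⟨e_1, …, e_{n+i}⟩ / ⟨e_1, …, e_{i-1}⟩`, which `π_i` identifies with `V`, and
its dimension drops from `2i - 1` to `i`. Passing from the `i`-th quotient to the next one kills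
`e_i` and adjoins `e_{n+i+1}`, and both of these play the role of `f_i`. So `W_i ⊆ W_{i+1}` says
exactly that `pr_i(V_i) ⊆ V_{i+1}` (`comp_torusIndex_succ`). This makes `ζ` a bijection onto Y
(`degFlagEquivY`).

Y is the Schubert variety (`closure_toFlag_schubertCell`). It is closed (`isClosed_Y`), stable under
`B`, and contains the `σ`-cell, hence contains its closure. Conversely, every flag is `b • F_J` with
`b ∈ B` and `F_J` a flag of coordinate subspaces, whose index sets `J` are the positions of last
nonzero coordinates. It remains to see that each `F_J` in Y lies in the closure of the cell
(`indexFlag_mem_closure`). If `J` is not the chain of `σ`, some transposition raises it to a chain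
`J'` still in Y (`IsBoundedChain.exists_raise`). A one-parameter family of `B`-translates of
`F_{J'}` then tends to `F_J`, and induction on the distance from the top applies.

Regularity of `ζ` and of its inverse comes from Plücker coordinates: in each factor both maps are
linear in them up to a scalar (`IsLinearMap`), because minors of a lifted basis are alternating
forms in the original basis and conversely. Such maps are morphisms (`IsLinearMap.isMorphism`). -/

theorem IsMultihomogeneous.eval_smul {p : MvPolynomial (Σ i, κ i) ℂ} {m : ι →₀ ℕ}
    (hp : IsMultihomogeneous p m) (r : ι → ℂ) (x : (Σ i, κ i) → ℂ) :
    MvPolynomial.eval (fun s => r s.1 * x s) p =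
      (m.prod fun i k => r i ^ k) * MvPolynomial.eval x p := by
  rw [MvPolynomial.eval_eq, MvPolynomial.eval_eq, Finset.mul_sum]
  refine Finset.sum_congr rfl fun d hd => ?_
  have hm : Finsupp.weight (fun s : Σ i, κ i => Finsupp.single s.1 1) d = m :=
    hp (MvPolynomial.mem_support_iff.mp hd)
  have hr : (m.prod fun i k => r i ^ k) = ∏ s ∈ d.support, r s.1 ^ d s := by
    rw [← hm, Finsupp.weight_apply, Finsupp.sum, ← Finsupp.prod_finsetSum_index]
    · refine Finset.prod_congr rfl fun s _ => ?_
      rw [Finsupp.smul_single, Finsupp.prod_single_index] <;> simp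
    · simp
    · intros; rw [pow_add]
  rw [hr]
  simp only [mul_pow, Finset.prod_mul_distrib]
  ring

/-- The pullback of a polynomial under the linear substitution with coefficients `L`. -/
def linearSubst [∀ i, Fintype (κ i)] (L : (i : ι) → κ' i → κ i → ℂ)
    (p : MvPolynomial (Σ i, κ' i) ℂ) : MvPolynomial (Σ i, κ i) ℂ :=
  MvPolynomial.bind₁ (fun s => ∑ k, MvPolynomial.C (L s.1 s.2 k) * MvPolynomial.X ⟨s.1, k⟩) p

theorem eval_linearSubst [∀ i, Fintype (κ i)] (L : (i : ι) → κ' i → κ i → ℂ)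
    (p : MvPolynomial (Σ i, κ' i) ℂ) (x : (Σ i, κ i) → ℂ) :
    MvPolynomial.eval x (linearSubst L p) =
      MvPolynomial.eval (fun s => ∑ k, L s.1 s.2 k * x ⟨s.1, k⟩) p := by
  rw [linearSubst, ← MvPolynomial.coe_aeval_eq_eval, RingHom.coe_coe, MvPolynomial.aeval_bind₁,
    ← MvPolynomial.coe_aeval_eq_eval]
  simp

theorem IsMultihomogeneous.linearSubst [∀ i, Fintype (κ i)] (L : (i : ι) → κ' i → κ i → ℂ)
    {p : MvPolynomial (Σ i, κ' i) ℂ} {m : ι →₀ ℕ} (hp : IsMultihomogeneous p m) :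
    IsMultihomogeneous (linearSubst L p) m := by
  rw [DegFlagSchubert.linearSubst, ← MvPolynomial.support_sum_monomial_coeff p, map_sum]
  refine (MvPolynomial.weightedHomogeneousSubmodule ℂ _ m).sum_mem fun d hd => ?_
  have hm : Finsupp.weight (fun s : Σ i, κ' i => Finsupp.single s.1 1) d = m :=
    hp (MvPolynomial.mem_support_iff.mp hd)
  rw [MvPolynomial.bind₁_monomial, MvPolynomial.mem_weightedHomogeneousSubmodule]
  refine MvPolynomial.IsWeightedHomogeneous.C_mul ?_ _
  rw [← hm, Finsupp.weight_apply, Finsupp.sum]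
  refine MvPolynomial.IsWeightedHomogeneous.prod _ _ _ fun s _ => ?_
  refine MvPolynomial.IsWeightedHomogeneous.pow ?_ _
  refine (MvPolynomial.weightedHomogeneousSubmodule ℂ _ _).sum_mem fun k _ => ?_
  rw [MvPolynomial.mem_weightedHomogeneousSubmodule]
  refine MvPolynomial.IsWeightedHomogeneous.C_mul ?_ _
  exact MvPolynomial.isWeightedHomogeneous_X ℂ (fun s : Σ i, κ i => Finsupp.single s.1 1)
    (⟨s.1, k⟩ : Σ i, κ i)

/-- `f` is given, up to rescaling in every factor, by linear forms in the homogeneous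
coordinates. -/
def IsLinearMap [∀ i, Fintype (κ i)] (c : X → (i : ι) → κ i → ℂ) (c' : Y → (i : ι) → κ' i → ℂ)
    (f : X → Y) : Prop :=
  ∃ L : (i : ι) → κ' i → κ i → ℂ, ∀ x i, ∃ r : ℂ, r ≠ 0 ∧
    ∀ k', c' (f x) i k' = r * ∑ k, L i k' k * c x i k

/-- The factor `r` depends on the point and the multidegree but not on `p`. It therefore leaves
vanishing loci unchanged and cancels in a quotient of two polynomials of the same multidegree. -/
theorem IsLinearMap.exists_eval [∀ i, Fintype (κ i)] {c : X → (i : ι) → κ i → ℂ}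
    {c' : Y → (i : ι) → κ' i → ℂ} {f : X → Y} (hf : IsLinearMap c c' f) :
    ∃ L : (i : ι) → κ' i → κ i → ℂ, ∀ x (m : ι →₀ ℕ), ∃ r : ℂ, r ≠ 0 ∧
      ∀ p : MvPolynomial (Σ i, κ' i) ℂ, IsMultihomogeneous p m →
      MvPolynomial.eval (fun s => c' (f x) s.1 s.2) p =
        r * MvPolynomial.eval (fun s => c x s.1 s.2) (linearSubst L p) := by
  obtain ⟨L, hL⟩ := hf
  refine ⟨L, fun x m => ?_⟩
  choose r hr0 hr using hL x
  refine ⟨m.prod fun i k => r i ^ k, ?_, fun p hp => ?_⟩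
  · exact Finset.prod_ne_zero_iff.mpr fun i _ => pow_ne_zero _ (hr0 i)
  · rw [eval_linearSubst, ← hp.eval_smul]
    simp only [hr]

theorem IsLinearMap.continuous [∀ i, Fintype (κ i)] {c : X → (i : ι) → κ i → ℂ}
    {c' : Y → (i : ι) → κ' i → ℂ} {f : X → Y} (hf : IsLinearMap c c' f) :
    Continuous[zariski c, zariski c'] f := by
  obtain ⟨L, hL⟩ := hf.exists_eval
  let _ := zariski c
  refine continuous_generateFrom_iff.mpr ?_
  rintro _ ⟨p, m, hp, rfl⟩
  refine TopologicalSpace.isOpen_generateFrom_of_mem ⟨linearSubst L p, m, hp.linearSubst L, ?_⟩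
  ext x
  obtain ⟨r, hr0, hr⟩ := hL x m
  simp [hr p hp, hr0]

theorem IsLinearMap.isMorphism [∀ i, Fintype (κ i)] {c : X → (i : ι) → κ i → ℂ}
    {c' : Y → (i : ι) → κ' i → ℂ} {f : X → Y} (hf : IsLinearMap c c' f) :
    IsMorphism c c' f := by
  refine ⟨hf.continuous, fun U h _ hh x hx => ?_⟩
  obtain ⟨L, hL⟩ := hf.exists_eval
  obtain ⟨p, q, m, D, hp, hq, hD, hxD, hpq⟩ := hh (f x) hx
  refine ⟨linearSubst L p, linearSubst L q, m, f ⁻¹' D, hp.linearSubst L, hq.linearSubst L,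
    @Continuous.isOpen_preimage _ _ (zariski c) (zariski c') _ hf.continuous D hD, hxD, fun y hy => ?_⟩
  obtain ⟨hq0, hy⟩ := hpq (f y) hy
  obtain ⟨r, hr0, hr⟩ := hL y m
  rw [hr q hq] at hq0 hy
  rw [hr p hp, mul_div_mul_left _ _ hr0] at hy
  exact ⟨right_ne_zero_of_mul hq0, hy⟩

/-- Curves with polynomial coordinates are continuous. -/
theorem continuous_curve {c : X → (i : ι) → κ i → ℂ} (γ : ℂ → X)
    (P : (i : ι) → κ i → Polynomial ℂ)
    (h : ∀ t i, ∃ r : ℂ, r ≠ 0 ∧ ∀ k, c (γ t) i k = r * (P i k).eval t) :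
    Continuous[inferInstance, zariski c]
      (fun t : CofiniteTopology ℂ => γ (CofiniteTopology.of.symm t)) := by
  refine continuous_generateFrom_iff.mpr ?_
  rintro _ ⟨p, m, hp, rfl⟩
  -- Along the curve, `p` is a nonzero multiple of the one-variable polynomial `q`. Its nonvanishing
  -- locus is empty if `q = 0` and cofinite otherwise.
  set q : Polynomial ℂ := MvPolynomial.aeval (fun s => P s.1 s.2) p with hq
  have key : ∀ t, MvPolynomial.eval (fun s => c (γ t) s.1 s.2) p ≠ 0 ↔ q.eval t ≠ 0 := by
    intro t
    choose r hr0 hr using h t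
    have hqt : q.eval t = MvPolynomial.eval (fun s => (P s.1 s.2).eval t) p := by
      rw [hq, ← Polynomial.coe_evalRingHom, MvPolynomial.map_aeval]
      rw [MvPolynomial.eval]
      congr 2
      ext; simp
    simp only [hr]
    rw [hp.eval_smul r (fun s => (P s.1 s.2).eval t), hqt]
    have : (m.prod fun i k => r i ^ k) ≠ 0 :=
      Finset.prod_ne_zero_iff.mpr fun i _ => pow_ne_zero _ (hr0 i)
    simp [this]
  rw [CofiniteTopology.isOpen_iff']
  by_cases h0 : q = 0
  · left
    ext t
    simp [key, h0, -ne_eq]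
  · right
    have := (Polynomial.finite_setOfPred_isRoot h0).preimage
      (CofiniteTopology.of (X := ℂ)).symm.injective.injOn
    refine this.subset fun t ht => ?_
    simpa [key, -ne_eq] using ht

/-- This replaces the limit `t → 0`: the line is infinite, so in the cofinite topology `0` is in the
closure of its complement, and continuity carries this over to `γ`. -/
theorem mem_closure_of_curve {c : X → (i : ι) → κ i → ℂ} {A : Set X} (γ : ℂ → X)
    (P : (i : ι) → κ i → Polynomial ℂ)
    (h : ∀ t i, ∃ r : ℂ, r ≠ 0 ∧ ∀ k, c (γ t) i k = r * (P i k).eval t)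
    (hA : ∀ t, t ≠ 0 → γ t ∈ closure[zariski c] A) : γ 0 ∈ closure[zariski c] A := by
  let _ := zariski c
  have hd : CofiniteTopology.of (0 : ℂ) ∈ closure {t | t ≠ CofiniteTopology.of (0 : ℂ)} := by
    rw [mem_closure_iff]
    intro U hU h0
    have hfin := CofiniteTopology.isOpen_iff.mp hU ⟨_, h0⟩
    by_contra hne
    have hsub : {t | t ≠ CofiniteTopology.of (0 : ℂ)} ⊆ Uᶜ :=
      fun t ht htU => hne ⟨t, htU, ht⟩
    have hinf : (Set.univ : Set (CofiniteTopology ℂ)).Finite :=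
      ((hfin.subset hsub).insert (CofiniteTopology.of 0)).subset fun t _ => by
        by_cases ht : t = CofiniteTopology.of 0
        · exact Or.inl ht
        · exact Or.inr ht
    exact Set.infinite_univ (α := ℂ)
      ((hinf.preimage (CofiniteTopology.of (X := ℂ)).injective.injOn).subset fun _ _ => trivial)
  have := map_mem_closure (continuous_curve γ P h) hd (t := closure A)
    (fun t ht => hA _ (fun h => ht (CofiniteTopology.of.symm.injective h)))
  rwa [closure_closure] at this

end Multiprojective

/-! ### Plücker coordinates and alternating forms -/

section Plucker

variable {d N : ℕ}

/-- The alternating form on `ℂ^N` given by the minor with row indices `r`. -/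
def minorForm (r : Fin d → Fin N) : (Fin N → ℂ) [⋀^Fin d]→ₗ[ℂ] ℂ :=
  Matrix.detRowAlternating.compLinearMap (LinearMap.funLeft ℂ ℂ r)

theorem minorForm_apply (r : Fin d → Fin N) (w : Fin d → Fin N → ℂ) :
    minorForm r w = (Matrix.of fun b a => w b (r a)).det :=
  rfl

theorem pluckerCoord_eq_minorForm (U : Grass d N) (S : Fin d ↪o Fin N) :
    pluckerCoord U S =
      minorForm S fun b => ((Module.finBasisOfFinrankEq ℂ U.1 U.2 b : U.1) : Fin N → ℂ) := by
  rw [minorForm_apply, ← Matrix.det_transpose]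
  rfl

/-- An alternating form is a linear functional on the exterior power. Expanding the wedge of the `w
b` in the standard basis gives the minors as coefficients. -/
theorem alternating_eq_sum_minorForm (φ : (Fin N → ℂ) [⋀^Fin d]→ₗ[ℂ] ℂ) (w : Fin d → Fin N → ℂ) :
    φ w = ∑ S : Fin d ↪o Fin N, φ (fun b => Pi.single (S b) 1) * minorForm S w := by
  rw [← exteriorPower.alternatingMapLinearEquiv_apply_ιMulti φ w]
  conv_lhs => rw [← ((Pi.basisFun ℂ (Fin N)).exteriorPower d).sum_repr (exteriorPower.ιMulti ℂ d w)]
  rw [map_sum, ← Equiv.sum_comp Set.powersetCard.ofFinEmbEquiv]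
  refine Finset.sum_congr rfl fun S _ => ?_
  rw [map_smul, exteriorPower.basis_apply, exteriorPower.ιMulti_family,
    exteriorPower.alternatingMapLinearEquiv_apply_ιMulti, ← Module.Basis.coord_apply,
    exteriorPower.basis_coord, exteriorPower.ιMultiDual_apply_ιMulti, smul_eq_mul, mul_comm]
  congr 1
  · congr 1
    funext b
    simp
  · rw [minorForm_apply]
    congr 1
    ext b a
    simp

/-- Changing the basis of `U` multiplies every alternating form of degree `d` by the same
determinant. This removes the arbitrary basis in the definition of `pluckerCoord`. -/
theorem exists_form_finBasis_eq (U : Grass d N) (u : Fin d → Fin N → ℂ)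
    (hu : LinearIndependent ℂ u) (hU : ∀ b, u b ∈ U.1) :
    ∃ r : ℂ, r ≠ 0 ∧ ∀ φ : (Fin N → ℂ) [⋀^Fin d]→ₗ[ℂ] ℂ,
      φ (fun b => ((Module.finBasisOfFinrankEq ℂ U.1 U.2 b : U.1) : Fin N → ℂ)) = r * φ u := by
  have hu' : LinearIndependent ℂ fun b => (⟨u b, hU b⟩ : U.1) :=
    LinearIndependent.of_comp U.1.subtype hu
  let e : Module.Basis (Fin d) ℂ U.1 := basisOfLinearIndependentOfCardEqFinrank' _ hu'
    (by rw [Fintype.card_fin, U.2])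
  have he : ∀ b, (e b : Fin N → ℂ) = u b := fun b => by simp [e]
  refine ⟨e.det (Module.finBasisOfFinrankEq ℂ U.1 U.2), (e.isUnit_det _).ne_zero, fun φ => ?_⟩
  have := congrArg (fun f => f (Module.finBasisOfFinrankEq ℂ U.1 U.2))
    ((φ.compLinearMap U.1.subtype).eq_smul_basis_det e)
  simp only [AlternatingMap.compLinearMap_apply, AlternatingMap.smul_apply, Submodule.subtype_apply,
    smul_eq_mul, he] at this
  rw [this, mul_comm]

/-- A minor is nonzero exactly when the coordinates in `S` restrict injectively to `U`, a square
matrix being singular iff it has a kernel. -/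
theorem pluckerCoord_ne_zero_iff (U : Grass d N) (S : Fin d ↪o Fin N) :
    pluckerCoord U S ≠ 0 ↔ ∀ w ∈ U.1, (∀ a, w (S a) = 0) → w = 0 := by
  set e := Module.finBasisOfFinrankEq ℂ U.1 U.2
  have hsum : ∀ (y : Fin d → ℂ) (k : Fin N),
      ((∑ b, y b • e b : U.1) : Fin N → ℂ) k = ∑ b, (e b : Fin N → ℂ) k * y b := by
    intro y k
    simp [mul_comm]
  rw [pluckerCoord, ne_eq, ← Matrix.exists_mulVec_eq_zero_iff]
  constructor
  · intro h w hw hS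
    by_contra hw0
    refine h ⟨e.equivFun ⟨w, hw⟩, ?_, ?_⟩
    · simpa using hw0
    · funext a
      change _ = (0 : ℂ)
      rw [← hS a]
      have := hsum (e.equivFun ⟨w, hw⟩) (S a)
      rw [e.sum_equivFun] at this
      exact this.symm
  · rintro h ⟨y, hy, hM⟩
    refine hy ?_
    have h0 := h _ (∑ b, y b • e b : U.1).2 fun a => by
      rw [hsum]
      exact congrFun hM a
    have h1 : (∑ b, y b • e b : U.1) = 0 := Subtype.ext h0
    funext b
    exact Fintype.linearIndependent_iff.mp e.linearIndependent y h1 b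

/-- Inserting fixed vectors in some of the arguments of an alternating form. -/
def insertForm {ι κ l M : Type} [AddCommGroup M] [Module ℂ M] (φ : M [⋀^ι]→ₗ[ℂ] ℂ)
    (e : κ ⊕ l ≃ ι) (u : κ → M) : M [⋀^l]→ₗ[ℂ] ℂ where
  toFun v := φ (Sum.elim u v ∘ e.symm)
  map_update_add' {_} v b x y := by
    classical
    simp only [Sum.elim_update_right, Function.update_comp_equiv, Equiv.symm_symm,
      φ.map_update_add]
  map_update_smul' {_} v b r x := by
    classical
    simp only [Sum.elim_update_right, Function.update_comp_equiv, Equiv.symm_symm,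
      φ.map_update_smul]
  map_eq_zero_of_eq' v a b h hab := by
    refine φ.map_eq_zero_of_eq _ (i := e (Sum.inr a)) (j := e (Sum.inr b)) ?_ ?_
    · simpa using h
    · simpa using hab

end Plucker

/-! ### Linear maps between families of Grassmannians -/

section Families

variable {n : ℕ} {d d' N N' : Fin n → ℕ} {X Y : Type}

/-- The criterion behind all regularity statements. The forms `Φ i S` do not depend on the point, so
their values on standard basis vectors serve as the coefficients. The bases `u` and `u'` may vary
freely, at the cost of the scalar. -/
theorem isLinearMap_of_forms (U : X → (i : Fin n) → Grass (d i) (N i))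
    (U' : Y → (i : Fin n) → Grass (d' i) (N' i)) (f : X → Y)
    (Φ : (i : Fin n) → (Fin (d' i) ↪o Fin (N' i)) → (Fin (N i) → ℂ) [⋀^Fin (d i)]→ₗ[ℂ] ℂ)
    (h : ∀ x i, ∃ (u : Fin (d i) → Fin (N i) → ℂ) (u' : Fin (d' i) → Fin (N' i) → ℂ),
      LinearIndependent ℂ u ∧ (∀ b, u b ∈ (U x i).1) ∧
      LinearIndependent ℂ u' ∧ (∀ b, u' b ∈ (U' (f x) i).1) ∧
      ∀ S : Fin (d' i) ↪o Fin (N' i), minorForm S u' = Φ i S u) :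
    IsLinearMap (fun x i S => pluckerCoord (U x i) S) (fun y i S => pluckerCoord (U' y i) S) f := by
  refine ⟨fun i S' S => Φ i S' (fun b => Pi.single (S b) 1), fun x i => ?_⟩
  obtain ⟨u, u', hu, hU, hu', hU', hS⟩ := h x i
  obtain ⟨r, hr0, hr⟩ := exists_form_finBasis_eq (U x i) u hu hU
  obtain ⟨r', hr0', hr'⟩ := exists_form_finBasis_eq (U' (f x) i) u' hu' hU'
  refine ⟨r' / r, div_ne_zero hr0' hr0, fun S' => ?_⟩
  simp only [pluckerCoord_eq_minorForm]
  rw [← alternating_eq_sum_minorForm, hr, hr', hS]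
  field_simp

end Families

/-! ### Coordinate subspaces and leading positions -/

section Leading

variable {N : ℕ}

/-- The span of the standard basis vectors with indices in `A`. -/
def coordSub (A : Finset (Fin N)) : Submodule ℂ (Fin N → ℂ) where
  carrier := {w | ∀ k ∉ A, w k = 0}
  zero_mem' _ _ := rfl
  add_mem' ha hb k hk := by simp [ha k hk, hb k hk]
  smul_mem' c w hw k hk := by simp [hw k hk]

theorem mem_coordSub {A : Finset (Fin N)} {w : Fin N → ℂ} :
    w ∈ coordSub A ↔ ∀ k ∉ A, w k = 0 :=
  Iff.rfl

theorem coordSub_mono {A B : Finset (Fin N)} (h : A ⊆ B) : coordSub A ≤ coordSub B :=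
  fun _ hw k hk => hw k fun hA => hk (h hA)

/-- Coordinates on a coordinate subspace. -/
def coordSubEquiv (A : Finset (Fin N)) : coordSub A ≃ₗ[ℂ] (A → ℂ) where
  toFun w a := w.1 a
  map_add' _ _ := rfl
  map_smul' _ _ := rfl
  invFun f := ⟨fun k => if h : k ∈ A then f ⟨k, h⟩ else 0, fun k hk => dif_neg hk⟩
  left_inv w := by
    ext k
    by_cases hk : k ∈ A
    · simp [hk]
    · simp [hk, w.2 k hk]
  right_inv f := by
    ext a
    simp

theorem finrank_coordSub (A : Finset (Fin N)) : Module.finrank ℂ (coordSub A) = A.card := by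
  rw [(coordSubEquiv A).finrank_eq]
  simp

open Classical in
/-- The positions of the last nonzero coordinates of the vectors of `U`. -/
def leading (U : Submodule ℂ (Fin N → ℂ)) : Finset (Fin N) :=
  Finset.univ.filter fun m => ∃ w ∈ U, w m = 1 ∧ ∀ k, m < k → w k = 0

theorem mem_leading {U : Submodule ℂ (Fin N → ℂ)} {m : Fin N} :
    m ∈ leading U ↔ ∃ w ∈ U, w m = 1 ∧ ∀ k, m < k → w k = 0 := by
  simp [leading]

theorem leading_mono {U U' : Submodule ℂ (Fin N → ℂ)} (h : U ≤ U') : leading U ⊆ leading U' := by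
  intro m hm
  rw [mem_leading] at hm ⊢
  obtain ⟨w, hw, h1⟩ := hm
  exact ⟨w, h hw, h1⟩

theorem exists_last_ne_zero {w : Fin N → ℂ} (hw : w ≠ 0) :
    ∃ m, w m ≠ 0 ∧ ∀ k, m < k → w k = 0 := by
  classical
  obtain ⟨j, hj⟩ := Function.ne_iff.mp hw
  obtain ⟨m, hm, hmax⟩ := (Finset.univ.filter fun k => w k ≠ 0).exists_maximal
    ⟨j, by simpa using hj⟩
  refine ⟨m, by simpa using hm, fun k hk => ?_⟩
  by_contra h
  exact absurd (hmax (by simpa using h) hk.le) (not_le.mpr hk)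

theorem exists_mem_leading {U : Submodule ℂ (Fin N → ℂ)} {w : Fin N → ℂ} (hwU : w ∈ U)
    (hw : w ≠ 0) : ∃ m ∈ leading U, w m ≠ 0 ∧ ∀ k, m < k → w k = 0 := by
  obtain ⟨m, hm, hk⟩ := exists_last_ne_zero hw
  refine ⟨m, mem_leading.mpr ⟨(w m)⁻¹ • w, U.smul_mem _ hwU, ?_, fun k h => ?_⟩, hm, hk⟩
  · simp [hm]
  · simp [hk k h]

/-- A nonzero vector of `U` does not vanish at its own leading position, so the coordinates at
leading positions are injective on `U`. -/
theorem finrank_le_card_leading (U : Submodule ℂ (Fin N → ℂ)) :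
    Module.finrank ℂ U ≤ (leading U).card := by
  let f : U →ₗ[ℂ] (leading U → ℂ) :=
    (LinearMap.funLeft ℂ ℂ (Subtype.val : leading U → Fin N)).comp U.subtype
  have hf : Function.Injective f := by
    rw [injective_iff_map_eq_zero]
    intro w hw
    by_contra h0
    obtain ⟨m, hm, hne, -⟩ := exists_mem_leading w.2 fun h => h0 (Subtype.ext h)
    exact hne (congrFun hw ⟨m, hm⟩)
  simpa using LinearMap.finrank_le_finrank_of_injective hf

end Leading

/-! ### The Bruhat decomposition of the set of partial flags -/

section Bruhat

variable {n : ℕ}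

theorem mem_coordSpan {m : ℕ} {v : Fin (2 * n) → ℂ} :
    v ∈ coordSpan n m ↔ ∀ k : Fin (2 * n), m ≤ k → v k = 0 := by
  constructor
  · intro hv
    induction hv using Submodule.span_induction with
    | mem x hx =>
      obtain ⟨j, hj, rfl⟩ := hx
      intro k hk
      rw [Pi.single_eq_of_ne]
      rintro rfl
      omega
    | zero => simp
    | add x y _ _ hx hy => intro k hk; simp [hx k hk, hy k hk]
    | smul c x _ hx => intro k hk; simp [hx k hk]
  · intro h
    rw [← Finset.univ_sum_single v]
    refine Submodule.sum_mem _ fun k _ => ?_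
    by_cases hk : m ≤ k
    · rw [h k hk, Pi.single_zero]
      exact Submodule.zero_mem _
    · have : (Pi.single k (v k) : Fin (2 * n) → ℂ) = v k • Pi.single k 1 := by
        rw [← Pi.single_smul, smul_eq_mul, mul_one]
      rw [this]
      exact Submodule.smul_mem _ _ (Submodule.subset_span ⟨k, by omega, rfl⟩)

theorem slEquiv_apply (g : SLG n) (v : Fin (2 * n) → ℂ) (k : Fin (2 * n)) :
    slEquiv g v k = ∑ j, (g : Matrix (Fin (2 * n)) (Fin (2 * n)) ℂ) k j * v j :=
  rfl

theorem slEquiv_single (g : SLG n) (j k : Fin (2 * n)) :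
    slEquiv g (Pi.single j 1) k = (g : Matrix (Fin (2 * n)) (Fin (2 * n)) ℂ) k j := by
  rw [slEquiv_apply, Finset.sum_eq_single j]
  · simp
  · intro l _ hl
    simp [hl]
  · simp

/-- Equality `W' = g W` can be checked on one inclusion. -/
theorem smul_flag_eq {g : SLG n} {W W' : PartialFlag n}
    (h : ∀ i, ∀ w ∈ (W.1 i).1, slEquiv g w ∈ (W'.1 i).1) : g • W = W' := by
  apply Subtype.ext
  funext i
  apply Subtype.ext
  refine Submodule.eq_of_le_of_finrank_eq ?_ ?_
  · rintro _ ⟨w, hw, rfl⟩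
    exact h i w hw
  · rw [((g • W).1 i).2, (W'.1 i).2]

/-- The index sets of flags of coordinate subspaces of dimensions `1, 3, …, 2n - 1`. -/
structure IsIndexChain (J : Fin n → Finset (Fin (2 * n))) : Prop where
  card : ∀ i, (J i).card = 2 * (i : ℕ) + 1
  mono : Monotone J

/-- The flag of coordinate subspaces with index sets `J`. -/
def indexFlag {J : Fin n → Finset (Fin (2 * n))} (hJ : IsIndexChain J) : PartialFlag n :=
  ⟨fun i => ⟨coordSub (J i), (finrank_coordSub _).trans (hJ.card i)⟩,
    fun _ _ h => coordSub_mono (hJ.mono h)⟩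

/-- Every partial flag is spanned by columns of an upper unitriangular matrix. -/
theorem exists_borel_leading (W : PartialFlag n) : ∃ b ∈ borel n, ∀ i,
    ∀ w ∈ coordSub (leading (W.1 i).1), slEquiv b w ∈ (W.1 i).1 := by
  have hu : ∀ m : Fin (2 * n), ∃ u : Fin (2 * n) → ℂ, u m = 1 ∧ (∀ k, m < k → u k = 0) ∧
      ∀ i, m ∈ leading (W.1 i).1 → u ∈ (W.1 i).1 := by
    intro m
    by_cases h : ∃ i, m ∈ leading (W.1 i).1
    -- Taking the vector from the first member of the flag in which `m` is leading places it in all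
    -- later members as well, so one column serves every `i`.
    · obtain ⟨i, hi, hmin⟩ := exists_minimal_of_wellFoundedLT (fun i => m ∈ leading (W.1 i).1) h
      obtain ⟨u, huW, hu1, hu0⟩ := mem_leading.mp hi
      refine ⟨u, hu1, hu0, fun j hj => W.2 i j ?_ huW⟩
      rcases le_total i j with h | h
      · exact h
      · exact hmin hj h
    · exact ⟨Pi.single m 1, by simp, fun k hk => Pi.single_eq_of_ne hk.ne' _,
        fun i hi => absurd ⟨i, hi⟩ h⟩
  choose u hu1 hu0 huW using hu
  let M : Matrix (Fin (2 * n)) (Fin (2 * n)) ℂ := Matrix.of fun k m => u m k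
  have hM : M.det = 1 := by
    refine (Matrix.det_of_isUpperTriangular (fun i j h => hu0 j i h)).trans ?_
    exact Finset.prod_eq_one fun m _ => hu1 m
  let b : SLG n := ⟨M, hM⟩
  refine ⟨b, fun i j h => hu0 j i h, fun i w hw => ?_⟩
  have : slEquiv b w = ∑ m, w m • u m := by
    funext k
    rw [slEquiv_apply]
    simp [b, M, mul_comm]
  rw [this]
  refine Submodule.sum_mem _ fun m _ => ?_
  by_cases hm : m ∈ leading (W.1 i).1
  · exact Submodule.smul_mem _ _ (huW m i hm)
  · rw [hw m hm, zero_smul]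
    exact Submodule.zero_mem _

/-- For the upper bound on the cardinality, the invertible `b` of `exists_borel_leading` embeds the
coordinate subspace on the leading positions into `W_i`. -/
theorem isIndexChain_leading (W : PartialFlag n) : IsIndexChain fun i => leading (W.1 i).1 where
  card i := by
    obtain ⟨b, -, hb⟩ := exists_borel_leading W
    refine le_antisymm ?_ ((W.1 i).2.symm.le.trans (finrank_le_card_leading _))
    rw [← finrank_coordSub, ← LinearEquiv.finrank_map_eq (slEquiv b)]
    refine (Submodule.finrank_mono ?_).trans (W.1 i).2.le
    rintro _ ⟨w, hw, rfl⟩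
    exact hb i w hw
  mono _ _ h := leading_mono (W.2 _ _ h)

theorem exists_borel_smul_indexFlag (W : PartialFlag n) :
    ∃ b ∈ borel n, b • indexFlag (isIndexChain_leading W) = W := by
  obtain ⟨b, hb, h⟩ := exists_borel_leading W
  exact ⟨b, hb, smul_flag_eq h⟩

/-- A permutation has a representative in `SL_{2n}`. -/
theorem exists_represents (hn : 1 ≤ n) (τ : Equiv.Perm (Fin (2 * n))) :
    ∃ w : SLG n, Represents w τ := by
  let z : Fin (2 * n) := ⟨0, by omega⟩
  -- The permutation matrix has determinant the sign of `τ`. Scaling one column by that sign brings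
  -- it to 1, and such a column exists because `n ≥ 1`.
  let ε : ℂ := ((Equiv.Perm.sign τ⁻¹ : ℤ) : ℂ)
  have hε : ε * ε = 1 := by
    rcases Int.units_eq_one_or (Equiv.Perm.sign τ⁻¹) with h | h <;> simp only [ε, h] <;> simp
  refine ⟨⟨(τ⁻¹).permMatrix ℂ * Matrix.diagonal (Function.update 1 z ε), ?_⟩, fun i j h => ?_⟩
  · rw [Matrix.det_mul, Matrix.det_permutation, Matrix.det_diagonal,
      Finset.prod_update_of_mem (Finset.mem_univ _)]
    simpa only [Pi.one_apply, Finset.prod_const_one, mul_one] using hε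
  · have : ¬ τ.symm i = j := fun h' => h (by rw [← h']; simp)
    simp [Matrix.mul_diagonal, Equiv.Perm.permMatrix, PEquiv.toMatrix_apply, this]

theorem Represents.smul_stdFlag {w : SLG n} {τ : Equiv.Perm (Fin (2 * n))} (hw : Represents w τ)
    {J : Fin n → Finset (Fin (2 * n))} (hJ : IsIndexChain J)
    (hτ : ∀ (i : Fin n) (k : Fin (2 * n)), (k : ℕ) < 2 * (i : ℕ) + 1 → τ k ∈ J i) :
    w • stdFlag n = indexFlag hJ := by
  refine smul_flag_eq fun i v hv => ?_
  have hv' := mem_coordSpan.mp hv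
  refine mem_coordSub.mpr fun r hr => ?_
  rw [slEquiv_apply]
  refine Finset.sum_eq_zero fun j _ => ?_
  by_cases hj : r = τ j
  · rw [hv' j, mul_zero]
    by_contra h
    exact hr (hj ▸ hτ i j (by omega))
  · rw [hw r j hj, zero_mul]

theorem card_lt_of_isLowerSet {N : ℕ} {A : Finset (Fin N)} (hA : IsLowerSet (A : Set (Fin N)))
    {k : Fin N} (hk : (k : ℕ) < A.card) : k ∈ A := by
  by_contra h
  have : A ⊆ Finset.Iio k := fun j hj => by
    rw [Finset.mem_Iio]
    by_contra hkj
    exact h (hA (not_lt.mp hkj) hj)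
  have := Finset.card_le_card this
  rw [Fin.card_Iio] at this
  omega

/-- Every chain of index sets is the image of the standard one under some permutation. -/
theorem IsIndexChain.exists_perm {J : Fin n → Finset (Fin (2 * n))} (hJ : IsIndexChain J) :
    ∃ τ : Equiv.Perm (Fin (2 * n)),
      ∀ (i : Fin n) (k : Fin (2 * n)), (k : ℕ) < 2 * (i : ℕ) + 1 → τ k ∈ J i := by
  classical
  -- `key m` is the stage at which `m` enters the chain. Sorting by it turns each `J i` into an
  -- initial segment of length `2i + 1`.
  let key : Fin (2 * n) → ℕ := fun m => (Finset.univ.filter fun i => m ∉ J i).card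
  have hkey : ∀ (i : Fin n) m, m ∈ J i ↔ key m ≤ i := by
    intro i m
    constructor
    · intro hm
      have : (Finset.univ.filter fun i => m ∉ J i) ⊆ Finset.Iio i := fun j hj => by
        rw [Finset.mem_Iio]
        by_contra h
        exact (Finset.mem_filter.mp hj).2 (hJ.mono (not_lt.mp h) hm)
      simpa using Finset.card_le_card this
    · intro hm
      by_contra h
      have : Finset.Iic i ⊆ (Finset.univ.filter fun i => m ∉ J i) := fun j hj => by
        refine Finset.mem_filter.mpr ⟨Finset.mem_univ _, fun hj' => h ?_⟩
        exact hJ.mono (Finset.mem_Iic.mp hj) hj'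
      have := Finset.card_le_card this
      rw [Fin.card_Iic] at this
      exact absurd (this.trans hm) (by omega)
  refine ⟨Tuple.sort key, fun i k hk => ?_⟩
  have hcard : ((J i).map (Tuple.sort key).symm.toEmbedding).card = 2 * (i : ℕ) + 1 := by
    rw [Finset.card_map, hJ.card]
  have hlow : IsLowerSet (((J i).map (Tuple.sort key).symm.toEmbedding : Finset _) :
      Set (Fin (2 * n))) := by
    intro a b hba ha
    simp only [Finset.coe_map, Equiv.coe_toEmbedding, Set.mem_image, Finset.mem_coe,
      Equiv.symm_apply_eq, exists_eq_right] at ha ⊢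
    rw [hkey] at ha ⊢
    exact (Tuple.monotone_sort key hba).trans ha
  have := card_lt_of_isLowerSet hlow (k := k) (by omega)
  simpa [Equiv.symm_apply_eq] using this

theorem toFlag_mk (g : SLG n) : toFlag n (QuotientGroup.mk g) = g • stdFlag n :=
  rfl

theorem toFlag_smul (g : SLG n) (x : GmodP n) : toFlag n (g • x) = g • toFlag n x :=
  MulAction.ofQuotientStabilizer_smul _ _ _ _

/-- For surjectivity, `W = b • F_J`, and `F_J` is the standard flag moved by a representative of a
permutation. -/
theorem toFlag_bijective (hn : 1 ≤ n) : Function.Bijective (toFlag n) := by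
  refine ⟨MulAction.injective_ofQuotientStabilizer _ _, fun W => ?_⟩
  obtain ⟨b, -, hb⟩ := exists_borel_smul_indexFlag W
  obtain ⟨τ, hτ⟩ := (isIndexChain_leading W).exists_perm
  obtain ⟨w, hw⟩ := exists_represents hn τ
  refine ⟨QuotientGroup.mk (b * w), ?_⟩
  rw [toFlag_mk, mul_smul, hw.smul_stdFlag (isIndexChain_leading W) hτ, hb]

end Bruhat

/-! ### The Zariski topology on partial flags -/

section FlagTopology

variable {n : ℕ}

/-- The Plücker coordinates of a partial flag. -/
def coordFlag (n : ℕ) (W : PartialFlag n) (i : Fin n)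
    (S : Fin (2 * (i : ℕ) + 1) ↪o Fin (2 * n)) : ℂ :=
  pluckerCoord (W.1 i) S

/-- Closures in `SL_{2n}/P` can thus be computed on flags. -/
theorem zariski_coordGmodP :
    zariski (coordGmodP n) = (zariski (coordFlag n)).induced (toFlag n) := by
  rw [zariski, zariski, induced_generateFrom_eq]
  congr 1
  ext D
  constructor
  · rintro ⟨p, m, hp, rfl⟩
    exact ⟨_, ⟨p, m, hp, rfl⟩, rfl⟩
  · rintro ⟨_, ⟨p, m, hp, rfl⟩, rfl⟩
    exact ⟨p, m, hp, rfl⟩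

/-- The basis of a member of a family of subspaces, as a family of vectors. -/
def basisVec {d N : ℕ} (U : Grass d N) (b : Fin d) : Fin N → ℂ :=
  (Module.finBasisOfFinrankEq ℂ U.1 U.2 b : U.1)

theorem basisVec_mem {d N : ℕ} (U : Grass d N) (b : Fin d) : basisVec U b ∈ U.1 :=
  Subtype.prop _

theorem linearIndependent_basisVec {d N : ℕ} (U : Grass d N) :
    LinearIndependent ℂ (basisVec U) :=
  (Module.finBasisOfFinrankEq ℂ U.1 U.2).linearIndependent.map' U.1.subtype
    (Submodule.ker_subtype _)

theorem linearIndependent_slEquiv {d : ℕ} (g : SLG n) {u : Fin d → Fin (2 * n) → ℂ}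
    (hu : LinearIndependent ℂ u) : LinearIndependent ℂ fun b => slEquiv g (u b) :=
  hu.map' (slEquiv g).toLinearMap (LinearEquiv.ker _)

theorem slEquiv_mem_smul (g : SLG n) {W : PartialFlag n} {i : Fin n} {w : Fin (2 * n) → ℂ}
    (hw : w ∈ (W.1 i).1) : slEquiv g w ∈ ((g • W).1 i).1 :=
  Submodule.mem_map_of_mem hw

theorem isLinearMap_smul (g : SLG n) :
    IsLinearMap (coordFlag n) (coordFlag n) (fun W => g • W) := by
  refine isLinearMap_of_forms (fun W : PartialFlag n => W.1) (fun W : PartialFlag n => W.1) _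
    (fun i S => (minorForm S).compLinearMap
      (slEquiv g : (Fin (2 * n) → ℂ) →ₗ[ℂ] (Fin (2 * n) → ℂ))) fun W i => ?_
  exact ⟨basisVec (W.1 i), fun b => slEquiv g (basisVec (W.1 i) b),
    linearIndependent_basisVec _, basisVec_mem _,
    linearIndependent_slEquiv g (linearIndependent_basisVec _),
    fun b => slEquiv_mem_smul g (basisVec_mem _ b), fun S => rfl⟩

theorem slEquiv_transvection {a c : Fin (2 * n)} (h : c ≠ a) (t : ℂ) (v : Fin (2 * n) → ℂ)
    (k : Fin (2 * n)) :
    slEquiv (Matrix.SpecialLinearGroup.transvection h t) v k =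
      v k + t * (if k = c then v a else 0) := by
  have hm : (Matrix.SpecialLinearGroup.transvection h t : Matrix (Fin (2 * n)) (Fin (2 * n)) ℂ) =
    Matrix.transvection c a t := rfl
  rw [slEquiv_apply]
  simp only [hm, Matrix.transvection, Matrix.add_apply, add_mul, Finset.sum_add_distrib,
    Matrix.one_apply, Matrix.single_apply]
  simp [ite_and, eq_comm]

theorem transvection_mem_borel {a c : Fin (2 * n)} (h : a < c) (t : ℂ) :
    Matrix.SpecialLinearGroup.transvection h.ne t ∈ borel n := by
  intro i j hij
  rw [← slEquiv_single, slEquiv_transvection]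
  rw [Pi.single_eq_of_ne hij.ne']
  by_cases hi : i = a
  · subst hi
    rw [Pi.single_eq_of_ne (hij.trans h).ne']
    simp
  · simp [hi]

/-- The minors of the transvected basis are polynomials in `t`. The scalar `r` absorbs the basis
chosen for each `t` in `pluckerCoord`. -/
theorem exists_polynomial_transvection_smul {a c : Fin (2 * n)} (h : c ≠ a) (W : PartialFlag n) :
    ∃ P : (i : Fin n) → (Fin (2 * (i : ℕ) + 1) ↪o Fin (2 * n)) → Polynomial ℂ,
      ∀ t i, ∃ r : ℂ, r ≠ 0 ∧ ∀ S,
        coordFlag n (Matrix.SpecialLinearGroup.transvection h t • W) i S =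
          r * (P i S).eval t := by
  refine ⟨fun i S => (Matrix.of fun b j => Polynomial.C (basisVec (W.1 i) b (S j)) +
    Polynomial.X * Polynomial.C (if S j = c then basisVec (W.1 i) b a else 0)).det,
    fun t i => ?_⟩
  set g := Matrix.SpecialLinearGroup.transvection h t
  obtain ⟨r, hr0, hr⟩ := exists_form_finBasis_eq ((g • W).1 i)
    (fun b => slEquiv g (basisVec (W.1 i) b))
    (linearIndependent_slEquiv g (linearIndependent_basisVec _))
    (fun b => slEquiv_mem_smul g (basisVec_mem _ b))
  refine ⟨r, hr0, fun S => ?_⟩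
  rw [coordFlag, pluckerCoord_eq_minorForm, hr, minorForm_apply, ← Polynomial.coe_evalRingHom,
    RingHom.map_det]
  congr 2
  ext b j
  simp [g, slEquiv_transvection, mul_comm t]

/-! ### The set `Y` is closed -/

theorem pluckerCoord_leading_ne_zero (W : PartialFlag n) (i : Fin n) :
    coordFlag n W i ((leading (W.1 i).1).orderEmbOfFin ((isIndexChain_leading W).card i)) ≠ 0 := by
  refine (pluckerCoord_ne_zero_iff _ _).mpr fun w hw h => ?_
  by_contra h0
  obtain ⟨m, hm, hne, -⟩ := exists_mem_leading hw h0
  rw [← Finset.mem_coe, ← Finset.range_orderEmbOfFin _ ((isIndexChain_leading W).card i)] at hm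
  obtain ⟨a, rfl⟩ := hm
  exact hne (h a)

/-- Triangular elimination: subtracting a multiple of the vector of `U` with leading position `l`
clears the last coordinate. -/
theorem coordSpan_le_of_subset_leading {U : Submodule ℂ (Fin (2 * n) → ℂ)} {m : ℕ}
    (h : ∀ k : Fin (2 * n), (k : ℕ) < m → k ∈ leading U) : coordSpan n m ≤ U := by
  induction m with
  | zero =>
    intro v hv
    have : v = 0 := funext fun k => mem_coordSpan.mp hv k (Nat.zero_le _)
    rw [this]
    exact U.zero_mem
  | succ l ih =>
    intro v hv
    rw [mem_coordSpan] at hv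
    have ih := ih fun k hk => h k (by omega)
    by_cases hl : l < 2 * n
    · obtain ⟨u, hu, hu1, hu0⟩ := mem_leading.mp (h ⟨l, hl⟩ (Nat.lt_succ_self l))
      have hvu : v - v ⟨l, hl⟩ • u ∈ U := ih <| mem_coordSpan.mpr fun k hk => by
        rcases hk.eq_or_lt with hk | hk
        · have : k = ⟨l, hl⟩ := Fin.ext hk.symm
          simp [this, hu1]
        · simp [hv k hk, hu0 k hk]
      simpa using U.add_mem hvu (U.smul_mem (v ⟨l, hl⟩) hu)
    · exact ih (mem_coordSpan.mpr fun k hk => absurd k.2 (by omega))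

theorem coordFlag_eq_zero_of_le {W : PartialFlag n} {i : Fin n} {m : ℕ}
    (h : (W.1 i).1 ≤ coordSpan n m) {S : Fin (2 * (i : ℕ) + 1) ↪o Fin (2 * n)}
    {a : Fin (2 * (i : ℕ) + 1)} (ha : m ≤ (S a : ℕ)) : coordFlag n W i S = 0 :=
  Matrix.det_eq_zero_of_row_eq_zero a fun _ => mem_coordSpan.mp (h (Subtype.prop _)) _ ha

theorem coordFlag_eq_zero_of_ge {W : PartialFlag n} {i : Fin n} {m : ℕ}
    (h : coordSpan n m ≤ (W.1 i).1) {S : Fin (2 * (i : ℕ) + 1) ↪o Fin (2 * n)}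
    {k : Fin (2 * n)} (hk : (k : ℕ) < m) (hS : k ∉ Set.range S) : coordFlag n W i S = 0 := by
  by_contra h0
  have := (pluckerCoord_ne_zero_iff _ _).mp h0 (Pi.single k 1)
    (h (Submodule.subset_span ⟨k, hk, rfl⟩)) fun a => Pi.single_eq_of_ne (fun e => hS ⟨a, e⟩) _
  simpa using congrFun this k

theorem isOpen_coordFlag_ne_zero (i : Fin n) (S : Fin (2 * (i : ℕ) + 1) ↪o Fin (2 * n)) :
    IsOpen[zariski (coordFlag n)] {W | coordFlag n W i S ≠ 0} := by
  refine TopologicalSpace.isOpen_generateFrom_of_mem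
    ⟨MvPolynomial.X ⟨i, S⟩, Finsupp.single i 1, ?_, ?_⟩
  · exact MvPolynomial.isWeightedHomogeneous_X ℂ _ _
  · simp

/-- For a flag outside `Y`, take an `i` where a bound fails and the Plücker coordinate of `W_i` at
its leading set. It is nonzero there but vanishes on all of `Y`: the leading set either misses an
index that `Y` forces or contains one that `Y` forbids. -/
theorem isClosed_Y : IsClosed[zariski (coordFlag n)] (Y n) := by
  let _ := zariski (coordFlag n)
  rw [← isOpen_compl_iff, isOpen_iff_forall_mem_open]
  intro W hW
  simp only [Y, Set.mem_compl_iff, Set.mem_ofPred_eq, not_forall] at hW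
  obtain ⟨i, hi⟩ := hW
  refine ⟨_, ?_, isOpen_coordFlag_ne_zero i _, pluckerCoord_leading_ne_zero W i⟩
  intro W' hW' hY
  refine hi ⟨coordSpan_le_of_subset_leading fun k hk => ?_, fun w hw => ?_⟩
  · by_contra hkS
    refine hW' (coordFlag_eq_zero_of_ge (hY i).1 hk ?_)
    simpa using hkS
  · rw [mem_coordSpan]
    by_contra hwS
    push Not at hwS
    obtain ⟨k, hk, hwk⟩ := hwS
    obtain ⟨m, hm, -, hm0⟩ := exists_mem_leading hw fun h => hwk (congrFun h k)
    have hkm : k ≤ m := not_lt.mp fun h => hwk (hm0 k h)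
    rw [← Finset.mem_coe, ← Finset.range_orderEmbOfFin _ ((isIndexChain_leading W).card i)] at hm
    obtain ⟨a, rfl⟩ := hm
    exact hW' (coordFlag_eq_zero_of_le (hY i).2 (hk.trans hkm))

end FlagTopology

/-! ### Coordinate flags in `Y` -/

section IndexChains

variable {n : ℕ}

/-- The index chains of the coordinate flags in `Y`. -/
structure IsBoundedChain (J : Fin n → Finset (Fin (2 * n))) : Prop extends IsIndexChain J where
  lower : ∀ (i : Fin n) (k : Fin (2 * n)), (k : ℕ) < i → k ∈ J i
  upper : ∀ (i : Fin n), ∀ k ∈ J i, (k : ℕ) < n + i + 1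

theorem card_filter_lt_or_mem_Ico {l m : ℕ} (hl : l ≤ n) (hm : m ≤ n) :
    (Finset.univ.filter fun k : Fin (2 * n) =>
      (k : ℕ) < l ∨ n ≤ (k : ℕ) ∧ (k : ℕ) < n + m).card = l + m := by
  rw [← Finset.card_map Fin.valEmbedding]
  have : (Finset.univ.filter fun k : Fin (2 * n) =>
      (k : ℕ) < l ∨ n ≤ (k : ℕ) ∧ (k : ℕ) < n + m).map Fin.valEmbedding =
      Finset.range l ∪ Finset.Ico n (n + m) := by
    ext x
    simp only [Finset.mem_map, Finset.mem_filter, Finset.mem_univ, true_and, Fin.valEmbedding_apply,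
      Finset.mem_union, Finset.mem_range, Finset.mem_Ico]
    constructor
    · rintro ⟨k, hk, rfl⟩
      exact hk
    · intro hx
      exact ⟨⟨x, by omega⟩, hx, rfl⟩
  rw [this, Finset.card_union_of_disjoint]
  · simp
  · rw [Finset.disjoint_left]
    intro x hx
    simp only [Finset.mem_range, Finset.mem_Ico] at hx ⊢
    omega

/-- A coordinate flag in `Y` outside the open cell can be raised by a transposition. -/
theorem IsBoundedChain.exists_raise {J : Fin n → Finset (Fin (2 * n))} (hJ : IsBoundedChain J)
    (h : ∃ i : Fin n, (⟨n + i, by omega⟩ : Fin (2 * n)) ∉ J i) :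
    ∃ a c : Fin (2 * n), a < c ∧ (∀ k, c ∈ J k → a ∈ J k) ∧
      (∀ k : Fin n, a ∈ J k → c ∉ J k → (k : ℕ) ≤ a ∧ (c : ℕ) < n + k + 1) ∧
      ∃ k, a ∈ J k ∧ c ∉ J k := by
  -- With indices from 0, the standard chain has `J k = [0, k) ∪ [n, n + k]`. The first deviation
  -- from it is at `i`, where `J i` has some `a` with `i ≤ a < n` in place of `n + i`. This `a` is
  -- the element to be raised.
  obtain ⟨i, hi, hmin⟩ := exists_minimal_of_wellFoundedLT
    (fun i : Fin n => (⟨n + i, by omega⟩ : Fin (2 * n)) ∉ J i) h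
  have hlt : ∀ k : Fin n, k < i → (⟨n + k, by omega⟩ : Fin (2 * n)) ∈ J k := by
    intro k hk
    by_contra hk'
    exact absurd (hmin hk' hk.le) (not_le.mpr hk)
  have hmem : ∀ (k : Fin n) (x : Fin (2 * n)), k ≤ i →
      ((x : ℕ) < k ∨ n ≤ (x : ℕ) ∧ (x : ℕ) < n + k) → x ∈ J k := by
    rintro k x hk (hx | ⟨hx1, hx2⟩)
    · exact hJ.lower k x hx
    · have hki : (k : ℕ) ≤ i := hk
      let l : Fin n := ⟨(x : ℕ) - n, by omega⟩
      have hl : l ≤ k := Fin.le_def.mpr (by simp only [l]; omega)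
      have := hJ.mono hl (hlt l (Fin.lt_def.mpr (by simp only [l]; omega)))
      convert this using 1
      apply Fin.ext
      simp only [l]
      omega
  -- the members of the chain below `i` are standard
  have hstd : ∀ (k : Fin n) (x : Fin (2 * n)), k < i → x ∈ J k →
      ((x : ℕ) < k ∨ n ≤ (x : ℕ) ∧ (x : ℕ) < n + k + 1) := by
    intro k x hk hx
    have hsub : (Finset.univ.filter fun x : Fin (2 * n) =>
        (x : ℕ) < k ∨ n ≤ (x : ℕ) ∧ (x : ℕ) < n + (k + 1)) ⊆ J k := by
      intro y hy
      rw [Finset.mem_filter] at hy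
      by_cases hy' : (y : ℕ) = n + k
      · have : y = ⟨n + k, by omega⟩ := Fin.ext hy'
        rw [this]
        exact hlt k hk
      · exact hmem k y hk.le (by omega)
    have := Finset.eq_of_subset_of_card_le hsub
      (by rw [card_filter_lt_or_mem_Ico (by omega) (by omega), hJ.card]; omega)
    rw [← this, Finset.mem_filter] at hx
    omega
  -- the extra element of `J i`
  set T := Finset.univ.filter fun x : Fin (2 * n) =>
    (x : ℕ) < i ∨ n ≤ (x : ℕ) ∧ (x : ℕ) < n + i with hT
  have hTJ : T ⊆ J i := fun y hy => hmem i y le_rfl (Finset.mem_filter.mp hy).2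
  have hTc : T.card = 2 * (i : ℕ) := by
    rw [hT, card_filter_lt_or_mem_Ico (by omega) (by omega)]
    omega
  obtain ⟨a, haJ, haT⟩ := Finset.exists_mem_notMem_of_card_lt_card
    (s := T) (t := J i) (by rw [hJ.card]; omega)
  have hJi : insert a T = J i := Finset.eq_of_subset_of_card_le
    (Finset.insert_subset haJ hTJ) (by rw [Finset.card_insert_of_notMem haT, hJ.card]; omega)
  have ha_up := hJ.upper i a haJ
  have ha_ne : (a : ℕ) ≠ n + i := fun e => hi (by
    convert haJ using 1
    exact Fin.ext e.symm)
  have ha : (i : ℕ) ≤ a ∧ (a : ℕ) < n := by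
    simp only [hT, Finset.mem_filter, Finset.mem_univ, true_and] at haT
    omega
  have ha_not : ∀ k, k < i → a ∉ J k := fun k hk hak => by
    have := hstd k a hk hak
    have : (k : ℕ) < i := hk
    omega
  -- The new element `c` must be absent from `J i` and allowed there. It must also be present in
  -- every `J k` with `k > a`, since those sets have to keep `a`.
  have key : ∃ c : Fin (2 * n), a < c ∧ c ∉ J i ∧ (c : ℕ) < n + i + 1 ∧
      ∀ k : Fin n, (a : ℕ) < k → c ∈ J k := by
    by_cases hlast : (a : ℕ) + 1 < n
    -- Counting: the excluded set has `(a + 1) + (a + 2) - 1 = 2a + 2` elements, while `J (a + 1)`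
    -- has `2a + 3`. With the upper bound on `J (a + 1)`, the remaining `c` is in `(a, n)` or equals
    -- `n + i`, so it avoids `J i`.
    · obtain ⟨c, hcJ, hc⟩ : ∃ c ∈ J ⟨a + 1, hlast⟩, ¬ ((c : ℕ) < a + 1 ∨
          n ≤ (c : ℕ) ∧ (c : ℕ) < n + a + 2 ∧ (c : ℕ) ≠ n + i) := by
        by_contra! hall
        have hsub : J ⟨a + 1, hlast⟩ ⊆ (Finset.univ.filter fun x : Fin (2 * n) =>
            (x : ℕ) < a + 1 ∨ n ≤ (x : ℕ) ∧ (x : ℕ) < n + (a + 2)).erase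
              ⟨n + i, by omega⟩ := by
          intro x hx
          have := hall x hx
          rw [Finset.mem_erase, Finset.mem_filter]
          refine ⟨fun e => ?_, Finset.mem_univ _, by omega⟩
          rw [e] at this
          simp only at this
          omega
        have := Finset.card_le_card hsub
        rw [Finset.card_erase_of_mem (by simp; omega),
          card_filter_lt_or_mem_Ico (by omega) (by omega), hJ.card] at this
        simp only at this
        omega
      have hcu := hJ.upper _ c hcJ
      simp only at hcu
      refine ⟨c, Fin.lt_def.mpr (by omega), fun hci => ?_, by omega, fun k hk => ?_⟩
      · rw [← hJi, Finset.mem_insert] at hci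
        rcases hci with rfl | hci
        · omega
        · rw [hT, Finset.mem_filter] at hci
          omega
      · exact hJ.mono (Fin.le_def.mpr (by simp only; omega)) hcJ
    -- Here `a = n - 1`, so no `k` exceeds `a` and the missing element `n + i` itself serves.
    · exact ⟨⟨n + i, by omega⟩, Fin.lt_def.mpr (by simp only; omega), hi, by simp,
        fun k hk => by omega⟩
  obtain ⟨c, hac, hci, hcu, hck⟩ := key
  refine ⟨a, c, hac, fun k hk => ?_, fun k hak hck' => ⟨?_, ?_⟩, i, haJ, hci⟩
  · rcases le_total i k with h | h
    · exact hJ.mono h haJ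
    · exact absurd (hJ.mono h hk) hci
  · by_contra hka
    exact hck' (hck k (by omega))
  · have : i ≤ k := not_lt.mp fun h => ha_not k h hak
    have : (i : ℕ) ≤ k := this
    omega

/-- The set `J k` changes only if it contains `a` but not `c`. There `h2` says that `a` is not
forced by the lower bound and that `c` respects the upper one. -/
theorem IsBoundedChain.swap {J : Fin n → Finset (Fin (2 * n))} (hJ : IsBoundedChain J)
    {a c : Fin (2 * n)} (hac : a < c) (h1 : ∀ k, c ∈ J k → a ∈ J k)
    (h2 : ∀ k : Fin n, a ∈ J k → c ∉ J k → (k : ℕ) ≤ a ∧ (c : ℕ) < n + k + 1) :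
    IsBoundedChain fun k => (J k).map (Equiv.swap a c).toEmbedding where
  card i := by rw [Finset.card_map, hJ.card]
  mono _ _ h := Finset.map_subset_map.mpr (hJ.mono h)
  lower i k hk := by
    rw [Finset.mem_map_equiv, Equiv.symm_swap]
    have hac' : (a : ℕ) < c := hac
    by_cases hka : k = a
    · subst hka
      rw [Equiv.swap_apply_left]
      by_contra hc
      have := h2 i (hJ.lower i k hk) hc
      omega
    by_cases hkc : k = c
    · subst hkc
      rw [Equiv.swap_apply_right]
      exact hJ.lower i a (by omega)
    rw [Equiv.swap_apply_of_ne_of_ne hka hkc]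
    exact hJ.lower i k hk
  upper i k hk := by
    rw [Finset.mem_map_equiv, Equiv.symm_swap] at hk
    by_cases hka : k = a
    · subst hka
      rw [Equiv.swap_apply_left] at hk
      exact hJ.upper i k (h1 i hk)
    by_cases hkc : k = c
    · subst hkc
      rw [Equiv.swap_apply_right] at hk
      by_cases hc : k ∈ J i
      · exact hJ.upper i k hc
      · exact (h2 i hk hc).2
    rw [Equiv.swap_apply_of_ne_of_ne hka hkc] at hk
    exact hJ.upper i k hk

/-- The total distance of an index chain from the top. -/
def chainDefect (J : Fin n → Finset (Fin (2 * n))) : ℕ :=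
  ∑ i, ∑ k ∈ J i, (2 * n - (k : ℕ))

theorem chainDefect_swap_lt {J : Fin n → Finset (Fin (2 * n))} {a c : Fin (2 * n)} (hac : a < c)
    (h1 : ∀ k, c ∈ J k → a ∈ J k) (h3 : ∃ k, a ∈ J k ∧ c ∉ J k) :
    chainDefect (fun k => (J k).map (Equiv.swap a c).toEmbedding) < chainDefect J := by
  have hac' : (a : ℕ) < c := hac
  have hle : ∀ k, c ∉ J k → ∀ x ∈ J k,
      2 * n - (Equiv.swap a c x : ℕ) ≤ 2 * n - (x : ℕ) := by
    intro k hc x hx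
    by_cases hxa : x = a
    · subst hxa
      rw [Equiv.swap_apply_left]
      omega
    · rw [Equiv.swap_apply_of_ne_of_ne hxa (fun e : x = c => hc (e ▸ hx))]
  refine Finset.sum_lt_sum (fun k _ => ?_) ?_
  · by_cases hc : c ∈ J k
    · have : (J k).map (Equiv.swap a c).toEmbedding = J k := by
        ext x
        rw [Finset.mem_map_equiv, Equiv.symm_swap]
        by_cases hxa : x = a
        · simp [hxa, hc, h1 k hc]
        by_cases hxc : x = c
        · simp [hxc, hc, h1 k hc]
        rw [Equiv.swap_apply_of_ne_of_ne hxa hxc]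
      exact (congrArg (fun A : Finset (Fin (2 * n)) => ∑ k ∈ A, (2 * n - (k : ℕ))) this).le
    · rw [Finset.sum_map]
      exact Finset.sum_le_sum (hle k hc)
  · obtain ⟨k, ha, hc⟩ := h3
    refine ⟨k, Finset.mem_univ _, ?_⟩
    rw [Finset.sum_map]
    refine Finset.sum_lt_sum (hle k hc) ⟨a, ha, ?_⟩
    simp only [Equiv.coe_toEmbedding, Equiv.swap_apply_left]
    omega

end IndexChains

/-! ### The Schubert variety as a set of flags -/

section Closure

variable {n : ℕ}

theorem smul_mem_closure_cell (n : ℕ) {b : SLG n} (hb : b ∈ borel n) {W : PartialFlag n}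
    (hW : W ∈ closure[zariski (coordFlag n)] (toFlag n '' schubertCell n (sigma n))) :
    b • W ∈ closure[zariski (coordFlag n)] (toFlag n '' schubertCell n (sigma n)) := by
  let _ := zariski (coordFlag n)
  refine map_mem_closure (isLinearMap_smul b).continuous hW ?_
  rintro _ ⟨_, ⟨b', hb', w, hw, rfl⟩, rfl⟩
  refine ⟨_, ⟨b * b', (borel n).mul_mem hb hb', w, hw, rfl⟩, ?_⟩
  rw [toFlag_mk, toFlag_mk, mul_assoc, mul_smul]

/-- The lower transvection sends `e_a` to `e_a + t e_c`, and the upper one then sends this to `t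
e_c`. So `a` is replaced by `c` where `c` is absent, and members containing both indices are
preserved. -/
theorem transvection_smul_indexFlag {J : Fin n → Finset (Fin (2 * n))} (hJ : IsIndexChain J)
    {a c : Fin (2 * n)} (hac : a < c) (h1 : ∀ k, c ∈ J k → a ∈ J k)
    (hJ' : IsIndexChain fun k => (J k).map (Equiv.swap a c).toEmbedding) {t : ℂ} (ht : t ≠ 0) :
    Matrix.SpecialLinearGroup.transvection hac.ne (-t⁻¹) •
      Matrix.SpecialLinearGroup.transvection hac.ne' t • indexFlag hJ = indexFlag hJ' := by
  rw [← mul_smul]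
  refine smul_flag_eq fun k w hw => mem_coordSub.mpr fun x hx => ?_
  have hmul : ∀ g h : SLG n, slEquiv (g * h) w = slEquiv g (slEquiv h w) := fun g h => by
    simp only [slEquiv, map_mul]
    rfl
  have hw : ∀ y ∉ J k, w y = 0 := hw
  rw [Finset.mem_map_equiv, Equiv.symm_swap] at hx
  simp only [hmul, slEquiv_transvection]
  by_cases hxa : x = a
  · subst hxa
    rw [Equiv.swap_apply_left] at hx
    simp [hac.ne, hw c hx, ht]
  by_cases hxc : x = c
  · subst hxc
    rw [Equiv.swap_apply_right] at hx
    simp [hac.ne', hw a hx, hw x (fun h => hx (h1 k h))]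
  rw [Equiv.swap_apply_of_ne_of_ne hxa hxc] at hx
  simp [hxa, hxc, hw x hx]

theorem indexFlag_mem_closure (hn : 1 ≤ n) {J : Fin n → Finset (Fin (2 * n))}
    (hJ : IsBoundedChain J) :
    indexFlag hJ.toIsIndexChain ∈
      closure[zariski (coordFlag n)] (toFlag n '' schubertCell n (sigma n)) := by
  let _ := zariski (coordFlag n)
  induction hd : chainDefect J using Nat.strong_induction_on generalizing J with
  | _ N ih =>
  by_cases h : ∃ i : Fin n, (⟨n + i, by omega⟩ : Fin (2 * n)) ∉ J i
  · obtain ⟨a, c, hac, h1, h2, h3⟩ := hJ.exists_raise h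
    have hJ' := hJ.swap hac h1 h2
    have hmem := ih _ (hd ▸ chainDefect_swap_lt hac h1 h3) hJ' rfl
    obtain ⟨P, hP⟩ := exists_polynomial_transvection_smul hac.ne' (indexFlag hJ.toIsIndexChain)
    -- For `t ≠ 0` the point of the curve is a `B`-translate of the raised flag, hence in the
    -- closure by induction. At `t = 0` it is the given flag.
    have := mem_closure_of_curve _ P hP fun t ht => by
      have hb := (borel n).inv_mem (transvection_mem_borel hac (-t⁻¹))
      have := smul_mem_closure_cell n hb hmem
      rwa [← transvection_smul_indexFlag hJ.toIsIndexChain hac h1 hJ'.toIsIndexChain ht,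
        inv_smul_smul] at this
    simpa using this
  · push Not at h
    obtain ⟨w, hw⟩ := exists_represents hn (sigma n)
    refine subset_closure ⟨QuotientGroup.mk (1 * w), ⟨1, (borel n).one_mem, w, hw, rfl⟩, ?_⟩
    rw [toFlag_mk, one_mul]
    -- No raise is possible, so `n + i ∈ J i` for all `i`. With the lower bounds, this forces the
    -- chain of `σ`.
    refine hw.smul_stdFlag hJ.toIsIndexChain fun i k hk => ?_
    by_cases hk2 : (k : ℕ) % 2 = 0
    · have : sigma n k = ⟨n + (k : ℕ) / 2, by omega⟩ := if_pos hk2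
      rw [this]
      exact hJ.mono (Fin.le_def.mpr (by simp only; omega)) (h ⟨(k : ℕ) / 2, by omega⟩)
    · have : sigma n k = ⟨(k : ℕ) / 2, by omega⟩ := if_neg hk2
      rw [this]
      exact hJ.lower i _ (by simp only; omega)

theorem isBoundedChain_leading {W : PartialFlag n} (hW : W ∈ Y n) :
    IsBoundedChain fun i => leading (W.1 i).1 where
  toIsIndexChain := isIndexChain_leading W
  lower i k hk := mem_leading.mpr ⟨Pi.single k 1,
    (hW i).1 (Submodule.subset_span ⟨k, hk, rfl⟩), by simp, fun j hj =>
      Pi.single_eq_of_ne hj.ne' _⟩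
  upper i k hk := by
    obtain ⟨w, hw, hw1, -⟩ := mem_leading.mp hk
    by_contra h
    rw [mem_coordSpan.mp ((hW i).2 hw) k (by omega)] at hw1
    exact zero_ne_one hw1

theorem borel_smul_coordSpan {b : SLG n} (hb : b ∈ borel n) {m : ℕ} {v : Fin (2 * n) → ℂ}
    (hv : v ∈ coordSpan n m) : slEquiv b v ∈ coordSpan n m := by
  rw [mem_coordSpan] at hv ⊢
  intro k hk
  rw [slEquiv_apply]
  refine Finset.sum_eq_zero fun j _ => ?_
  by_cases hj : j < k
  · rw [hb k j hj, zero_mul]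
  · rw [hv j (hk.trans (Fin.le_def.mp (not_lt.mp hj))), mul_zero]

theorem borel_smul_mem_Y {b : SLG n} (hb : b ∈ borel n) {W : PartialFlag n} (hW : W ∈ Y n) :
    b • W ∈ Y n := by
  intro i
  constructor
  · intro v hv
    refine ⟨slEquiv b⁻¹ v, (hW i).1 (borel_smul_coordSpan ((borel n).inv_mem hb) hv), ?_⟩
    have : slEquiv b (slEquiv b⁻¹ v) = slEquiv (b * b⁻¹) v := by
      simp only [slEquiv, map_mul]
      rfl
    rw [LinearEquiv.coe_coe, this]
    simp [slEquiv]
  · rintro _ ⟨v, hv, rfl⟩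
    exact borel_smul_coordSpan hb ((hW i).2 hv)

theorem isIndexChain_sigma (n : ℕ) : IsIndexChain fun i : Fin n =>
    Finset.univ.filter fun k : Fin (2 * n) =>
      (k : ℕ) < i ∨ n ≤ (k : ℕ) ∧ (k : ℕ) < n + (i + 1) where
  card i := by
    rw [card_filter_lt_or_mem_Ico (by omega) (by omega)]
    omega
  mono i j h k hk := by
    have : (i : ℕ) ≤ j := h
    simp only [Finset.mem_filter, Finset.mem_univ, true_and] at hk ⊢
    omega

theorem toFlag_schubertCell_subset : toFlag n '' schubertCell n (sigma n) ⊆ Y n := by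
  rintro _ ⟨_, ⟨b, hb, w, hw, rfl⟩, rfl⟩
  rw [toFlag_mk, mul_smul]
  refine borel_smul_mem_Y hb ?_
  rw [hw.smul_stdFlag (isIndexChain_sigma n) fun i k hk => ?_]
  · refine fun i => ⟨fun v hv => mem_coordSub.mpr fun k hk => mem_coordSpan.mp hv k ?_,
      fun v hv => mem_coordSpan.mpr fun k hk => mem_coordSub.mp hv k ?_⟩
    all_goals
      simp only [Finset.mem_filter, Finset.mem_univ, true_and] at *
      omega
  · simp only [Finset.mem_filter, Finset.mem_univ, true_and]
    by_cases hk2 : (k : ℕ) % 2 = 0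
    · have : sigma n k = ⟨n + (k : ℕ) / 2, by omega⟩ := if_pos hk2
      simp only [this]
      omega
    · have : sigma n k = ⟨(k : ℕ) / 2, by omega⟩ := if_neg hk2
      simp only [this]
      omega

theorem closure_toFlag_schubertCell (hn : 1 ≤ n) :
    closure[zariski (coordFlag n)] (toFlag n '' schubertCell n (sigma n)) = Y n := by
  let _ := zariski (coordFlag n)
  refine subset_antisymm (closure_minimal toFlag_schubertCell_subset isClosed_Y) fun W hW => ?_
  obtain ⟨b, hb, hbW⟩ := exists_borel_smul_indexFlag W
  rw [← hbW]
  exact smul_mem_closure_cell n hb (indexFlag_mem_closure hn (isBoundedChain_leading hW))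

theorem schubertVariety_sigma (hn : 1 ≤ n) :
    schubertVariety n (sigma n) = toFlag n ⁻¹' Y n := by
  let _ := zariski (coordFlag n)
  let _ := zariski (coordGmodP n)
  have hind : Topology.IsInducing (toFlag n) := ⟨zariski_coordGmodP⟩
  rw [schubertVariety, ← closure_toFlag_schubertCell hn]
  exact hind.closure_eq_preimage_closure_image _

end Closure

/-! ### The subspaces `π_i⁻¹(U)` -/

section Preimage

variable {n : ℕ}

theorem torusIndex_of_lt {i : Fin n} {k : Fin (n + 1)} (h : (k : ℕ) < i) :
    (torusIndex i k : ℕ) = n + 1 + k := by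
  simp [torusIndex, h]

theorem torusIndex_of_le {i : Fin n} {k : Fin (n + 1)} (h : (i : ℕ) ≤ k) :
    (torusIndex i k : ℕ) = k := by
  simp [torusIndex, not_lt.mpr h]

theorem le_torusIndex (i : Fin n) (k : Fin (n + 1)) : (i : ℕ) ≤ torusIndex i k := by
  rcases lt_or_ge (k : ℕ) i with h | h
  · rw [torusIndex_of_lt h]; omega
  · rwa [torusIndex_of_le h]

theorem torusIndex_lt (i : Fin n) (k : Fin (n + 1)) : (torusIndex i k : ℕ) < n + i + 1 := by
  rcases lt_or_ge (k : ℕ) i with h | h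
  · rw [torusIndex_of_lt h]; omega
  · rw [torusIndex_of_le h]; omega

theorem torusIndex_injective (i : Fin n) : Function.Injective (torusIndex i) := by
  intro k l h
  have h := congrArg Fin.val h
  apply Fin.ext
  rcases lt_or_ge (k : ℕ) i with hk | hk <;> rcases lt_or_ge (l : ℕ) i with hl | hl
  · rw [torusIndex_of_lt hk, torusIndex_of_lt hl] at h; omega
  · rw [torusIndex_of_lt hk, torusIndex_of_le hl] at h; omega
  · rw [torusIndex_of_le hk, torusIndex_of_lt hl] at h; omega
  · rw [torusIndex_of_le hk, torusIndex_of_le hl] at h; omega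

theorem exists_torusIndex_eq {i : Fin n} {j : Fin (2 * n)} (h1 : (i : ℕ) ≤ j)
    (h2 : (j : ℕ) < n + i + 1) : ∃ k, torusIndex i k = j := by
  by_cases hj : (j : ℕ) ≤ n
  · exact ⟨⟨j, by omega⟩, Fin.ext (torusIndex_of_le h1)⟩
  · refine ⟨⟨(j : ℕ) - n - 1, by omega⟩, Fin.ext ?_⟩
    rw [torusIndex_of_lt (by simp only; omega)]
    simp only
    omega

theorem torusIndex_eq_of_ne {i j : Fin n} (h : (j : ℕ) = i + 1) {k : Fin (n + 1)}
    (hk : k ≠ i.castSucc) : torusIndex j k = torusIndex i k := by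
  have hk' : (k : ℕ) ≠ i := fun e => hk (Fin.ext e)
  apply Fin.ext
  rcases lt_or_ge (k : ℕ) i with hki | hki
  · rw [torusIndex_of_lt hki, torusIndex_of_lt (by omega)]
  · rw [torusIndex_of_le hki, torusIndex_of_le (by omega)]

/-- In coordinates `π_i` merely reads off the entries at the positions `torusIndex i k`. The same
indexing governs the torus action, whence equivariance. -/
theorem piMap_apply {i : Fin n} (w : coordSpan n (n + (i : ℕ) + 1)) (k : Fin (n + 1)) :
    piMap i w k = (w : Fin (2 * n) → ℂ) (torusIndex i k) := by
  rw [piMap, LinearMap.domRestrict_apply, Module.Basis.constr_apply_fintype, Finset.sum_apply,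
    Finset.sum_eq_single (torusIndex i k)]
  · have h1 := le_torusIndex i k
    rw [if_neg (not_lt.mpr h1)]
    rcases lt_or_ge (k : ℕ) i with h | h
    · have h2 := torusIndex_of_lt h
      rw [dif_neg (by omega)]
      have : (⟨(torusIndex i k : ℕ) - n - 1, by omega⟩ : Fin (n + 1)) = k :=
        Fin.ext (by simp only; omega)
      simp [this]
    · have h2 := torusIndex_of_le h
      rw [dif_pos (by omega)]
      have : (⟨(torusIndex i k : ℕ), by omega⟩ : Fin (n + 1)) = k := Fin.ext h2
      simp [this]
  · intro j _ hj
    by_cases hju : n + (i : ℕ) + 1 ≤ j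
    · simp [mem_coordSpan.mp w.2 j hju]
    split_ifs with h1 h2
    · simp
    · rw [Pi.smul_apply, Pi.single_eq_of_ne, smul_zero]
      rintro rfl
      refine hj (Fin.ext ?_)
      rw [torusIndex_of_le (by simp only; omega)]
    · rw [Pi.smul_apply, Pi.single_eq_of_ne, smul_zero]
      rintro rfl
      refine hj (Fin.ext ?_)
      rw [torusIndex_of_lt (by simp only; omega)]
      simp only
      omega
  · simp

theorem mem_piPreimage {i : Fin n} {U : Submodule ℂ (Fin (n + 1) → ℂ)} {w : Fin (2 * n) → ℂ} :
    w ∈ piPreimage i U ↔ w ∈ coordSpan n (n + (i : ℕ) + 1) ∧ w ∘ torusIndex i ∈ U := by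
  have h : ∀ w' : coordSpan n (n + (i : ℕ) + 1),
      piMap i w' = (w' : Fin (2 * n) → ℂ) ∘ torusIndex i := fun w' => funext (piMap_apply w')
  constructor
  · rintro ⟨w', hw', rfl⟩
    refine ⟨w'.2, ?_⟩
    have : piMap i w' ∈ U := hw'
    rwa [h] at this
  · rintro ⟨hw, hwU⟩
    refine ⟨⟨w, hw⟩, ?_, rfl⟩
    change piMap i _ ∈ U
    rwa [h]

/-- The section `f_k ↦ e_{torusIndex i k}` of `π_i`. -/
def piSection (i : Fin n) : (Fin (n + 1) → ℂ) →ₗ[ℂ] (Fin (2 * n) → ℂ) :=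
  Function.ExtendByZero.linearMap ℂ (torusIndex i)

theorem piSection_torusIndex (i : Fin n) (v : Fin (n + 1) → ℂ) (k : Fin (n + 1)) :
    piSection i v (torusIndex i k) = v k :=
  (torusIndex_injective i).extend_apply v (0 : Fin (2 * n) → ℂ) k

theorem piSection_comp_torusIndex (i : Fin n) (v : Fin (n + 1) → ℂ) :
    piSection i v ∘ torusIndex i = v :=
  funext (piSection_torusIndex i v)

theorem piSection_of_lt {i : Fin n} (v : Fin (n + 1) → ℂ) {j : Fin (2 * n)} (h : (j : ℕ) < i) :
    piSection i v j = 0 :=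
  Function.extend_apply' v (0 : Fin (2 * n) → ℂ) j fun ⟨k, hk⟩ => by
    have := le_torusIndex i k
    rw [hk] at this
    omega

theorem piSection_mem_coordSpan (i : Fin n) (v : Fin (n + 1) → ℂ) :
    piSection i v ∈ coordSpan n (n + (i : ℕ) + 1) :=
  mem_coordSpan.mpr fun j hj => Function.extend_apply' v (0 : Fin (2 * n) → ℂ) j fun ⟨k, hk⟩ => by
    have := torusIndex_lt i k
    rw [hk] at this
    omega

theorem piSection_mem_piPreimage {i : Fin n} {U : Submodule ℂ (Fin (n + 1) → ℂ)}
    {v : Fin (n + 1) → ℂ} : piSection i v ∈ piPreimage i U ↔ v ∈ U := by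
  rw [mem_piPreimage, piSection_comp_torusIndex]
  exact and_iff_right (piSection_mem_coordSpan i v)

theorem sub_piSection_mem {i : Fin n} {w : Fin (2 * n) → ℂ}
    (hw : w ∈ coordSpan n (n + (i : ℕ) + 1)) :
    w - piSection i (w ∘ torusIndex i) ∈ coordSpan n i := by
  have hd := Submodule.sub_mem _ hw (piSection_mem_coordSpan i (w ∘ torusIndex i))
  refine mem_coordSpan.mpr fun j hj => ?_
  by_cases hju : n + (i : ℕ) + 1 ≤ j
  · exact mem_coordSpan.mp hd j hju
  · obtain ⟨k, rfl⟩ := exists_torusIndex_eq hj (not_le.mp hju)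
    rw [Pi.sub_apply, piSection_torusIndex]
    exact sub_self _

theorem coordSpan_mono {l m : ℕ} (h : l ≤ m) : coordSpan n l ≤ coordSpan n m :=
  fun _ hv => mem_coordSpan.mpr fun k hk => mem_coordSpan.mp hv k (h.trans hk)

theorem coordSpan_le_piPreimage (i : Fin n) (U : Submodule ℂ (Fin (n + 1) → ℂ)) :
    coordSpan n i ≤ piPreimage i U := by
  intro v hv
  refine mem_piPreimage.mpr ⟨coordSpan_mono (by omega) hv, ?_⟩
  have : v ∘ torusIndex i = 0 := funext fun k => mem_coordSpan.mp hv _ (le_torusIndex i k)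
  rw [this]
  exact U.zero_mem

/-- A vector of `⟨e_1, …, e_{n+i}⟩` differs from the lift of its image by an element of the kernel
of `π_i`, which `W` contains by `h1`. -/
theorem piPreimage_comap_piSection {i : Fin n} {W : Submodule ℂ (Fin (2 * n) → ℂ)}
    (h1 : coordSpan n i ≤ W) (h2 : W ≤ coordSpan n (n + (i : ℕ) + 1)) :
    piPreimage i (W.comap (piSection i)) = W := by
  ext w
  rw [mem_piPreimage]
  constructor
  · rintro ⟨hw, hwW⟩
    simpa using W.add_mem (h1 (sub_piSection_mem hw)) hwW
  · intro hw
    refine ⟨h2 hw, ?_⟩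
    simpa using W.sub_mem hw (h1 (sub_piSection_mem (h2 hw)))

/-- The vectors `e_1, …, e_{i-1}` together with lifts of the vectors `v`. -/
def liftFamily (i : Fin n) {d : ℕ} (v : Fin d → Fin (n + 1) → ℂ) :
    Fin (i : ℕ) ⊕ Fin d → Fin (2 * n) → ℂ :=
  Sum.elim (fun a => Pi.single (Fin.castLE (by omega) a) 1) (fun b => piSection i (v b))

theorem linearIndependent_liftFamily (i : Fin n) {d : ℕ} {v : Fin d → Fin (n + 1) → ℂ}
    (hv : LinearIndependent ℂ v) : LinearIndependent ℂ (liftFamily i v) := by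
  rw [Fintype.linearIndependent_iff] at hv ⊢
  intro g hg
  rw [Fintype.sum_sum_type] at hg
  simp only [liftFamily, Sum.elim_inl, Sum.elim_inr] at hg
  rintro (a | b)
  · have := congrFun hg (Fin.castLE (by omega) a)
    simp only [Pi.add_apply, Finset.sum_apply, Pi.smul_apply] at this
    rw [Finset.sum_eq_single a, Finset.sum_eq_zero] at this
    · simpa using this
    · intro b _
      rw [piSection_of_lt _ (by simp), smul_zero]
    · intro a' _ ha'
      rw [Pi.single_eq_of_ne, smul_zero]
      exact fun e => ha' (Fin.castLE_injective _ e).symm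
    · simp
  · refine hv (fun b => g (Sum.inr b)) (funext fun k => ?_) b
    have := congrFun hg (torusIndex i k)
    simp only [Pi.add_apply, Finset.sum_apply, Pi.smul_apply, piSection_torusIndex] at this
    rw [Finset.sum_eq_zero, zero_add] at this
    · simpa using this
    · intro a _
      rw [Pi.single_eq_of_ne, smul_zero]
      intro e
      have h1 := le_torusIndex i k
      rw [e] at h1
      have h2 := a.2
      simp only [Fin.val_castLE] at h1
      omega

theorem liftFamily_mem {i : Fin n} {d : ℕ} {v : Fin d → Fin (n + 1) → ℂ}
    {U : Submodule ℂ (Fin (n + 1) → ℂ)} (hv : ∀ b, v b ∈ U) (s : Fin (i : ℕ) ⊕ Fin d) :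
    liftFamily i v s ∈ piPreimage i U := by
  rcases s with a | b
  · exact coordSpan_le_piPreimage i U (Submodule.subset_span ⟨_, by simp, rfl⟩)
  · exact piSection_mem_piPreimage.mpr (hv b)

/-- The kernel vectors and the lifts of a basis of `U` form a basis of the preimage. -/
theorem finrank_piPreimage (i : Fin n) (U : Submodule ℂ (Fin (n + 1) → ℂ)) :
    Module.finrank ℂ (piPreimage i U) = i + Module.finrank ℂ U := by
  let u : Fin (Module.finrank ℂ U) → Fin (n + 1) → ℂ := basisVec ⟨U, rfl⟩
  have hspan : Submodule.span ℂ (Set.range (liftFamily i u)) = piPreimage i U := by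
    refine le_antisymm (Submodule.span_le.mpr ?_) fun w hw => ?_
    · rintro _ ⟨s, rfl⟩
      exact liftFamily_mem (fun b => basisVec_mem (⟨U, rfl⟩ : Grass _ _) b) s
    · have hw' := mem_piPreimage.mp hw
      rw [← sub_add_cancel w (piSection i (w ∘ torusIndex i))]
      refine Submodule.add_mem _ ?_ ?_
      · refine Submodule.span_mono ?_ (sub_piSection_mem hw'.1)
        rintro _ ⟨k, hk, rfl⟩
        exact ⟨Sum.inl ⟨k, hk⟩, rfl⟩
      · have hU : Submodule.span ℂ (Set.range u) = U := by
          have hr : Set.range u = U.subtype '' Set.range (Module.finBasisOfFinrankEq ℂ U rfl) := by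
            rw [← Set.range_comp]
            rfl
          rw [hr, ← Submodule.map_span, Module.Basis.span_eq, Submodule.map_top,
            Submodule.range_subtype]
        have hle : U.map (piSection i) ≤ Submodule.span ℂ (Set.range (liftFamily i u)) := by
          refine (Submodule.map_mono hU.ge).trans ?_
          rw [Submodule.map_span, Submodule.span_le]
          rintro _ ⟨_, ⟨b, rfl⟩, rfl⟩
          exact Submodule.subset_span ⟨Sum.inr b, rfl⟩
        exact hle (Submodule.mem_map_of_mem hw'.2)
  rw [← hspan, finrank_span_eq_card (linearIndependent_liftFamily i (linearIndependent_basisVec _))]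
  simp

/-- The minors of `v` are minors of `liftFamily i v`. -/
theorem minorForm_liftFamily (i : Fin n) {d m : ℕ} (v : Fin d → Fin (n + 1) → ℂ)
    (e : Fin (i : ℕ) ⊕ Fin d ≃ Fin m) (S : Fin d → Fin (n + 1)) :
    minorForm (Sum.elim (fun a : Fin (i : ℕ) => Fin.castLE (by omega) a)
      (torusIndex i ∘ S) ∘ e.symm) (liftFamily i v ∘ e.symm) = minorForm S v := by
  rw [minorForm_apply, minorForm_apply, ← Matrix.det_submatrix_equiv_self e]
  have : (Matrix.of fun b a => (liftFamily i v ∘ e.symm) b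
      ((Sum.elim (fun a : Fin (i : ℕ) => Fin.castLE (by omega) a)
        (torusIndex i ∘ S) ∘ e.symm) a)).submatrix e e =
      Matrix.fromBlocks 1 0 0 (Matrix.of fun b a => v b (S a)) := by
    ext s s'
    rcases s with a | b <;> rcases s' with a' | b'
    · simp [liftFamily, Matrix.one_apply, Pi.single_apply, Fin.ext_iff, eq_comm]
    · have h1 := le_torusIndex i (S b')
      have : torusIndex i (S b') ≠ Fin.castLE (by omega) a := fun h => by
        rw [h] at h1
        have h2 := a.2
        simp only [Fin.val_castLE] at h1
        omega
      simp [liftFamily, this]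
    · simpa [liftFamily] using piSection_of_lt (v b) (by simp)
    · simp [liftFamily, piSection_torusIndex]
  rw [this, Matrix.det_fromBlocks_zero₂₁, Matrix.det_one, one_mul]

end Preimage

/-! ### The isomorphism -/

section Isomorphism

variable {n : ℕ}

/-- The positions read by `π_i` and `π_{i+1}` differ only for the vector killed by `pr_i`. There the
later map reads a position just beyond the range of `w`, where `w` vanishes. -/
theorem comp_torusIndex_succ {i j : Fin n} (h : (j : ℕ) = i + 1) {w : Fin (2 * n) → ℂ}
    (hw : w ∈ coordSpan n (n + (i : ℕ) + 1)) :
    w ∘ torusIndex j = pr n i.castSucc (w ∘ torusIndex i) := by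
  funext k
  by_cases hk : k = i.castSucc
  · have hk' : (k : ℕ) = i := by rw [hk]; rfl
    have h1 : (torusIndex j k : ℕ) = n + 1 + k := torusIndex_of_lt (by omega)
    have : pr n i.castSucc (w ∘ torusIndex i) k = 0 := by simp [pr, hk]
    rw [this]
    exact mem_coordSpan.mp hw _ (by omega)
  · simp [pr, hk, torusIndex_eq_of_ne h hk]

theorem piPreimage_mono (V : DegFlag n) (i j : Fin n) (h : i ≤ j) :
    piPreimage i (V.1 i).1 ≤ piPreimage j (V.1 j).1 := by
  obtain ⟨m, hm⟩ : ∃ m : ℕ, (j : ℕ) = i + m := Nat.exists_eq_add_of_le h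
  clear h
  induction m generalizing j with
  | zero =>
    obtain rfl : j = i := Fin.ext hm
    exact le_rfl
  | succ m ih =>
    let l : Fin n := ⟨(i : ℕ) + m, by omega⟩
    refine (ih l rfl).trans fun w hw => ?_
    have hjl : (j : ℕ) = l + 1 := hm
    obtain ⟨hw1, hw2⟩ := mem_piPreimage.mp hw
    refine mem_piPreimage.mpr ⟨coordSpan_mono (by omega) hw1, ?_⟩
    rw [comp_torusIndex_succ hjl hw1]
    exact V.2 l j hjl (Submodule.mem_map_of_mem hw2)

/-- The flag `π_1⁻¹(V_1) ⊆ ⋯ ⊆ π_n⁻¹(V_n)`. -/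
def preimageFlag (V : DegFlag n) : PartialFlag n :=
  ⟨fun i => ⟨piPreimage i (V.1 i).1, by rw [finrank_piPreimage, (V.1 i).2]; omega⟩,
    piPreimage_mono V⟩

theorem preimageFlag_mem_Y (V : DegFlag n) : preimageFlag V ∈ Y n :=
  fun i => ⟨coordSpan_le_piPreimage i _, fun _ hw => (mem_piPreimage.mp hw).1⟩

/-- The degenerate flag variety is in bijection with `Y`. -/
def degFlagEquivY (n : ℕ) : DegFlag n ≃ Y n where
  toFun V := ⟨preimageFlag V, preimageFlag_mem_Y V⟩
  invFun W := ⟨fun i => ⟨(W.1.1 i).1.comap (piSection i), by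
      have h1 := finrank_piPreimage i ((W.1.1 i).1.comap (piSection i))
      rw [piPreimage_comap_piSection (W.2 i).1 (W.2 i).2, (W.1.1 i).2] at h1
      omega⟩, by
    rintro i j h _ ⟨v, hv, rfl⟩
    have hv' := W.1.2 i j (Fin.le_def.mpr (by omega)) hv
    rw [← piPreimage_comap_piSection (W.2 j).1 (W.2 j).2] at hv'
    have := (mem_piPreimage.mp hv').2
    rwa [comp_torusIndex_succ h (piSection_mem_coordSpan i v), piSection_comp_torusIndex] at this⟩
  left_inv V := by
    apply Subtype.ext
    funext i
    apply Subtype.ext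
    ext v
    exact piSection_mem_piPreimage
  right_inv W := by
    apply Subtype.ext
    apply Subtype.ext
    funext i
    apply Subtype.ext
    exact piPreimage_comap_piSection (W.2 i).1 (W.2 i).2

/-- The isomorphism of the degenerate flag variety with the Schubert variety `X_σ`. -/
def degFlagEquivSchubert (hn : 1 ≤ n) : DegFlag n ≃ schubertVariety n (sigma n) :=
  (degFlagEquivY n).trans
    ((Equiv.ofBijective _ (toFlag_bijective hn)).subtypeEquiv fun x => by
      rw [schubertVariety_sigma hn]
      rfl).symm

theorem toFlag_degFlagEquivSchubert (hn : 1 ≤ n) (V : DegFlag n) :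
    toFlag n (degFlagEquivSchubert hn V : GmodP n) = preimageFlag V :=
  (Equiv.ofBijective _ (toFlag_bijective hn)).apply_symm_apply _

theorem preimageFlag_smul (t : torus n) (V : DegFlag n) :
    preimageFlag (t • V) = (t : SLG n) • preimageFlag V := by
  refine (smul_flag_eq fun i w hw => ?_).symm
  obtain ⟨hw1, hw2⟩ := mem_piPreimage.mp hw
  have ht : ∀ k, slEquiv (t : SLG n) w k =
      ((t : SLG n) : Matrix (Fin (2 * n)) (Fin (2 * n)) ℂ) k k * w k := fun k => by
    rw [slEquiv_apply, Finset.sum_eq_single k]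
    · intro j _ hj
      rw [t.2 k j hj.symm, zero_mul]
    · simp
  refine mem_piPreimage.mpr ⟨mem_coordSpan.mpr fun k hk => ?_, ?_⟩
  · rw [ht, mem_coordSpan.mp hw1 k hk, mul_zero]
  · refine ⟨w ∘ torusIndex i, hw2, funext fun k => ?_⟩
    exact (ht _).symm

/-- A numbering of the members of `liftFamily`. -/
def liftIndexEquiv (i : Fin n) : Fin (i : ℕ) ⊕ Fin ((i : ℕ) + 1) ≃ Fin (2 * (i : ℕ) + 1) :=
  finSumFinEquiv.trans (finCongr (by omega))

theorem liftFamily_spec (hn : 1 ≤ n) (V : DegFlag n) (i : Fin n) :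
    LinearIndependent ℂ (liftFamily i (basisVec (V.1 i)) ∘ (liftIndexEquiv i).symm) ∧
      ∀ b, (liftFamily i (basisVec (V.1 i)) ∘ (liftIndexEquiv i).symm) b ∈
        ((toFlag n (degFlagEquivSchubert hn V)).1 i).1 := by
  refine ⟨(linearIndependent_liftFamily i (linearIndependent_basisVec _)).comp _
    (Equiv.injective _), fun b => ?_⟩
  rw [toFlag_degFlagEquivSchubert]
  exact liftFamily_mem (fun b => basisVec_mem _ b) _

theorem isLinearMap_degFlagEquivSchubert (hn : 1 ≤ n) :
    IsLinearMap (coordDegFlag n) (coordSchubert n (sigma n)) (degFlagEquivSchubert hn) := by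
  refine isLinearMap_of_forms (fun V : DegFlag n => V.1)
    (fun x : schubertVariety n (sigma n) => (toFlag n x.1).1) _
    -- A minor of the lifted basis is an alternating form in the vectors being lifted, the kernel
    -- vectors being fixed arguments.
    (fun i S => (insertForm (minorForm S) (liftIndexEquiv i)
      (fun a => Pi.single (Fin.castLE (by omega) a) 1)).compLinearMap (piSection i)) fun V i => ?_
  obtain ⟨h1, h2⟩ := liftFamily_spec hn V i
  exact ⟨basisVec (V.1 i), _, linearIndependent_basisVec _, basisVec_mem _, h1, h2, fun S => rfl⟩

theorem isLinearMap_degFlagEquivSchubert_symm (hn : 1 ≤ n) :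
    IsLinearMap (coordSchubert n (sigma n)) (coordDegFlag n) (degFlagEquivSchubert hn).symm := by
  refine isLinearMap_of_forms (fun x : schubertVariety n (sigma n) => (toFlag n x.1).1)
    (fun V : DegFlag n => V.1) _
    -- The rows are those of the kernel vectors followed by the positions of `S`. They need not be
    -- increasing, since `torusIndex i` is not monotone in general, which is why `minorForm` allows
    -- arbitrary row sequences.
    (fun i S => minorForm (Sum.elim (fun a : Fin (i : ℕ) => Fin.castLE (by omega) a)
      (torusIndex i ∘ S) ∘ (liftIndexEquiv i).symm)) fun x i => ?_
  obtain ⟨V, rfl⟩ := (degFlagEquivSchubert hn).surjective x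
  rw [Equiv.symm_apply_apply]
  obtain ⟨h1, h2⟩ := liftFamily_spec hn V i
  exact ⟨_, basisVec (V.1 i), h1, h2, linearIndependent_basisVec _, basisVec_mem _,
    fun S => (minorForm_liftFamily i _ _ S).symm⟩

end Isomorphism

end

end DegFlagSchubert

theorem theorem1p2 (n : ℕ) (hn : 1 ≤ n) :
    Function.Bijective (DegFlagSchubert.toFlag n) ∧
    ∃ ζ : DegFlagSchubert.DegFlag n ≃
        DegFlagSchubert.schubertVariety n (DegFlagSchubert.sigma n),
      DegFlagSchubert.IsVarietyIso (DegFlagSchubert.coordDegFlag n)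
        (DegFlagSchubert.coordSchubert n (DegFlagSchubert.sigma n)) ζ ∧
      (∀ (t : DegFlagSchubert.torus n) (V : DegFlagSchubert.DegFlag n),
        (ζ (t • V) : DegFlagSchubert.GmodP n) =
          (t : DegFlagSchubert.SLG n) • (ζ V : DegFlagSchubert.GmodP n)) ∧
      (∀ (V : DegFlagSchubert.DegFlag n) (i : Fin n),
        ((DegFlagSchubert.toFlag n (ζ V)).1 i).1 =
          DegFlagSchubert.piPreimage i (V.1 i).1) ∧
      DegFlagSchubert.toFlag n ''
          DegFlagSchubert.schubertVariety n (DegFlagSchubert.sigma n) =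
        DegFlagSchubert.Y n := by
  have hbij := DegFlagSchubert.toFlag_bijective hn
  refine ⟨hbij, DegFlagSchubert.degFlagEquivSchubert hn,
    ⟨(DegFlagSchubert.isLinearMap_degFlagEquivSchubert hn).isMorphism,
      (DegFlagSchubert.isLinearMap_degFlagEquivSchubert_symm hn).isMorphism⟩,
    fun t V => ?_, fun V i => ?_, ?_⟩
  · apply hbij.1
    rw [DegFlagSchubert.toFlag_smul, DegFlagSchubert.toFlag_degFlagEquivSchubert,
      DegFlagSchubert.toFlag_degFlagEquivSchubert, DegFlagSchubert.preimageFlag_smul]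
  · rw [DegFlagSchubert.toFlag_degFlagEquivSchubert]
    rfl
  · rw [DegFlagSchubert.schubertVariety_sigma hn, Set.image_preimage_eq _ hbij.2]
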